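/- Let $E$ be a finite set with the discrete $\sigma$-algebra and let $(X,(\mathbb P_x)_{x\in E})$ be an irreducible Markov jump process on $E$, that is: $X=(X_t)_{t\ge0}$ is an $E$-valued process with right-continuous, piecewise constant paths; each $\mathbb P_x$ is a probability measure with $\mathbb P_x(X_0=x)=1$; for all $x\in E$, $t\ge 0$ and all bounded measurable $A:E^{[0,\infty)}\to\mathbb R$, $\mathbb P_x$-almost surely, $$\mathbb E_x[A((X_{t+s})_{s\ge0})\mid (X_r)_{r\le t}]=\mathbb E_x[A((X_{t+s})_{s\ge0})\mid X_t]=\mathbb E_{X_t}[A((X_s)_{s\ge0})];$$ and $\mathbb P_x(\exists t\ge 0: X_t=y)>0$ for all $x,y\in E$. Let $\pi$ be its invariant distribution, $\nu$ any probability measure on $E$, and $\mathbb P_\nu=\sum_{x}\nu_x\mathbb P_x$. Let $\langle g,h\rangle=\sum_x\pi_x g(x)h(x)$ and $\|\cdot\|_2$ be the inner product and norm of $L^2(\pi)=\mathbb R^E$. Let $L$ be the infinitesimal generator, $Lg=\lim_{h\downarrow0}\frac{P_hg-g}{h}$ with $(P_hg)(x)=\mathbb E_x[g(X_h)]$, and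 $L^*$ its adjoint in $L^2(\pi)$. Let $S$ be the reduced resolvent of $\frac{L+L^*}2$ with respect to the eigenvalue $0$: the operator that vanishes on $\operatorname{Ker}\frac{L+L^*}2$ and is the inverse of $\frac{L+L^*}2$ on the sum of its other eigenspaces. Let $f:E\to\mathbb R$ satisfy $f\neq0$ and $\pi(f)=\sum_x\pi_xf(x)=0$, and put $$A_t=\int_0^tf(X_s)\,ds,\quad \hat\sigma_f^2=-2\langle f,Sf\rangle,\quad \lambda_1=\min_{\lambda\in\sigma(\frac{L+L^*}2)\setminus\{0\}}|\lambda|,\quad f^+=\max\{0,f\},\quad \|f^+\|_\infty=\max_{x\in E}f^+(x).$$ For $r\in\mathbb R$ let $\lambda_0(r)$ be the largest eigenvalue of $\frac{L+L^*}2+rM_f$, where $M_fg=fg$. Then for all $t>0$ and all $u\ge0$ $$\mathbb P_\nu\Big(\frac{A_t}{t}\ge u\Big)\le\Big\|\frac{d\nu}{d\pi}\Big\|_2\exp\left(-\frac{2tu^2}{\hat\sigma_f^2\Big(1+\sqrt{1+\frac{2\|f^+\|_\infty u}{\lambda_1\hat\sigma_f^2}}\Big)^2}\right),\qquad \frac{d\nu}{d\pi}(x)=\frac{\nu_x}{\pi_x},$$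 and for all $0\le r<\lambda_1/\|f^+\|_\infty$ $$\lambda_0(r)\le\frac{r^2\,\hat\sigma_f^2/2}{1-\frac{\|f^+\|_\infty}{\lambda_1}r}.$$ -/

import Mathlib

open Filter Topology MeasureTheory
open scoped NNReal

/-- A right-continuous, uniformly bounded one-parameter semigroup in a Banach algebra has a
derivative from the right at `0`. -/
theorem exists_semigroup_deriv {A : Type*} [NormedRing A] [NormedAlgebra ℝ A] [CompleteSpace A]
    (T : ℝ≥0 → A) (h0 : T 0 = 1) (hadd : ∀ s t, T (s + t) = T s * T t) (C : ℝ)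
    (hC : ∀ t, ‖T t‖ ≤ C) (hlim : Tendsto T (𝓝[>] 0) (𝓝 1)) :
    ∃ a : A, Tendsto (fun h : ℝ≥0 => (h : ℝ)⁻¹ • (T h - 1)) (𝓝[>] 0) (𝓝 a) := by
  have hlim0 : Tendsto T (𝓝 0) (𝓝 1) := by
    have : 𝓝[≥] (0 : ℝ≥0) = 𝓝 0 := by
      rw [show Set.Ici (0 : ℝ≥0) = Set.univ by ext; simp, nhdsWithin_univ]
    rw [← this, ← Set.Ioi_insert, nhdsWithin_insert]
    refine Tendsto.sup ?_ hlim
    rw [tendsto_pure_left]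
    intro s hs
    rw [h0]
    exact mem_of_mem_nhds hs
  have hC0 : 0 ≤ C := (norm_nonneg _).trans (hC 0)
  have key : ∀ s t : ℝ≥0, s ≤ t → ‖T t - T s‖ ≤ C * ‖T (t - s) - 1‖ := by
    intro s t hst
    have : T t - T s = T s * (T (t - s) - 1) := by
      rw [mul_sub, ← hadd, mul_one, add_tsub_cancel_of_le hst]
    rw [this]
    exact (norm_mul_le _ _).trans (mul_le_mul_of_nonneg_right (hC s) (norm_nonneg _))
  have hcont : Continuous T := by
    rw [continuous_iff_continuousAt]
    intro t
    have hd : Tendsto (fun s : ℝ≥0 => (t - s) + (s - t)) (𝓝 t) (𝓝 0) := by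
      have : Continuous fun s : ℝ≥0 => (t - s) + (s - t) := by fun_prop
      simpa using this.tendsto t
    have h2 : Tendsto (fun s : ℝ≥0 => C * ‖T ((t - s) + (s - t)) - 1‖) (𝓝 t) (𝓝 0) := by
      have := (((hlim0.comp hd).sub_const 1).norm).const_mul C
      simpa using this
    rw [ContinuousAt, tendsto_iff_norm_sub_tendsto_zero]
    refine squeeze_zero (fun _ => norm_nonneg _) (fun s => ?_) h2
    rcases le_total s t with h | h
    · rw [norm_sub_rev, tsub_eq_zero_of_le h, add_zero]
      exact key s t h
    · rw [tsub_eq_zero_of_le h, zero_add]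
      exact key t s h
  set F : ℝ → A := fun t => T t.toNNReal with hF
  have hFc : Continuous F := hcont.comp continuous_real_toNNReal
  have hF0 : F 0 = 1 := by simp [hF, h0]
  have hFadd : ∀ s t : ℝ, 0 ≤ s → 0 ≤ t → F (s + t) = F s * F t := by
    intro s t hs ht
    simp only [hF]
    rw [Real.toNNReal_add hs ht, hadd]
  set M : ℝ → A := fun d => ∫ s in (0 : ℝ)..d, F s with hM
  have hMd : ∀ d, HasDerivAt M (F d) d := fun d => hFc.integral_hasStrictDerivAt 0 d |>.hasDerivAt
  have hM0 : M 0 = 0 := by simp [hM]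
  have hunit : ∃ d : ℝ, 0 < d ∧ IsUnit (M d) := by
    have h1 : Tendsto (fun d : ℝ => d⁻¹ • M d) (𝓝[>] 0) (𝓝 1) := by
      have := (hMd 0).tendsto_slope_zero_right
      simpa [hM0, hF0] using this
    have h2 : ∀ᶠ d in 𝓝[>] (0 : ℝ), IsUnit (d⁻¹ • M d) :=
      h1.eventually (Units.isOpen.mem_nhds isUnit_one)
    obtain ⟨d, hd, hd0⟩ := (h2.and self_mem_nhdsWithin).exists
    refine ⟨d, hd0, ?_⟩
    have hdne : d ≠ 0 := ne_of_gt hd0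
    obtain ⟨w, hw⟩ := hd
    refine ⟨(Units.mk0 d hdne) • w, ?_⟩
    rw [Units.val_smul, hw, Units.smul_mk0, smul_inv_smul₀ hdne]
  obtain ⟨d, hd, w, hw⟩ := hunit
  have hid : ∀ h : ℝ, 0 ≤ h → (F h - 1) * M d = (M (d + h) - M d) - M h := by
    intro h hh
    have e1 : F h * M d = ∫ s in (0 : ℝ)..d, F (s + h) := by
      have e0 := (ContinuousLinearMap.mul ℝ A (F h)).intervalIntegral_comp_comm
        (hFc.intervalIntegrable (μ := volume) 0 d)
      simp only [ContinuousLinearMap.mul_apply'] at e0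
      simp only [hM]
      rw [← e0]
      refine intervalIntegral.integral_congr fun s hs => ?_
      rw [Set.uIcc_of_le hd.le] at hs
      change F h * F s = F (s + h)
      rw [add_comm, hFadd h s hh hs.1]
    have e2 : ∫ s in (0 : ℝ)..d, F (s + h) = M (d + h) - M h := by
      rw [intervalIntegral.integral_comp_add_right, zero_add]
      exact (intervalIntegral.integral_interval_sub_left (hFc.intervalIntegrable _ _)
        (hFc.intervalIntegrable _ _)).symm
    rw [sub_mul, one_mul, e1, e2]
    abel
  have hmain : Tendsto (fun h : ℝ => h⁻¹ • (F h - 1)) (𝓝[>] 0) (𝓝 ((F d - 1) * ↑w⁻¹)) := by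
    have t1 := (hMd d).tendsto_slope_zero_right
    have t2 := (hMd 0).tendsto_slope_zero_right
    simp only [zero_add, hM0, sub_zero, hF0] at t2
    refine ((t1.sub t2).mul_const (↑w⁻¹ : A)).congr' ?_
    filter_upwards [self_mem_nhdsWithin] with h hh
    rw [← smul_sub, ← hid h (le_of_lt hh), ← hw, smul_mul_assoc, mul_assoc, Units.mul_inv, mul_one]
  refine ⟨_, (hmain.comp (f := fun h : ℝ≥0 => (h : ℝ)) (x := 𝓝[>] 0) ?_).congr fun h => ?_⟩
  · refine tendsto_nhdsWithin_iff.2 ⟨?_, ?_⟩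
    · exact (NNReal.continuous_coe.tendsto' 0 0 rfl).mono_left nhdsWithin_le_nhds
    · filter_upwards [self_mem_nhdsWithin] with h hh
      exact NNReal.coe_pos.2 hh
  · simp [hF]

/-- A Markov jump process on `E` with underlying measurable space `Ω`: a process `X` with
right-continuous (locally constant to the right) paths, together with a family `P x` of laws,
under which it starts at `x` and has the Markov property. -/
structure MarkovJumpProcess (Ω E : Type*) [MeasurableSpace Ω] [MeasurableSpace E] where
  X : ℝ≥0 → Ω → E
  P : E → Measure Ω
  isProbabilityMeasure : ∀ x, IsProbabilityMeasure (P x)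
  measurable_X : ∀ t, Measurable (X t)
  jump : ∀ ω t, ∃ ε : ℝ≥0, 0 < ε ∧ ∀ h ≤ ε, X (t + h) ω = X t ω
  start : ∀ x, P x {ω | X 0 ω = x} = 1
  markov_past : ∀ (x : E) (t : ℝ≥0) (A : (ℝ≥0 → E) → ℝ), Measurable A → (∃ C, ∀ p, |A p| ≤ C) →
    (P x)[fun ω => A (fun s => X (t + s) ω) |
        ⨆ r : ℝ≥0, ⨆ _ : r ≤ t, MeasurableSpace.comap (X r) inferInstance]
      =ᵐ[P x] fun ω => ∫ ω', A (fun s => X s ω') ∂(P (X t ω))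
  markov_present : ∀ (x : E) (t : ℝ≥0) (A : (ℝ≥0 → E) → ℝ), Measurable A →
    (∃ C, ∀ p, |A p| ≤ C) →
    (P x)[fun ω => A (fun s => X (t + s) ω) | MeasurableSpace.comap (X t) inferInstance]
      =ᵐ[P x] fun ω => ∫ ω', A (fun s => X s ω') ∂(P (X t ω))

namespace MarkovJumpProcess

variable {Ω E : Type*} [MeasurableSpace Ω] [Fintype E] [MeasurableSpace E]
  [DiscreteMeasurableSpace E]

/-- The transition function `p_{xy}(t) = P_x(X_t = y)`. -/
noncomputable def transition (M : MarkovJumpProcess Ω E) (t : ℝ≥0) (x y : E) : ℝ :=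
  (M.P x).real {ω | M.X t ω = y}

/-- Every state is reached from every state with positive probability. -/
def IsIrreducible (M : MarkovJumpProcess Ω E) : Prop :=
  ∀ x y, 0 < M.P x {ω | ∃ t, M.X t ω = y}

/-- `μ` is a probability vector with `μᵀ P(t) = μᵀ` for all `t`. -/
def IsInvariant (M : MarkovJumpProcess Ω E) (μ : E → ℝ) : Prop :=
  μ ∈ stdSimplex ℝ E ∧ ∀ t y, ∑ x, μ x * M.transition t x y = μ y

/-- The law `P_ν = ∑ x, ν_x P_x` of the process started from the distribution `ν`. -/
noncomputable def law (M : MarkovJumpProcess Ω E) (ν : E → ℝ) : Measure Ω :=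
  ∑ x, ENNReal.ofReal (ν x) • M.P x

/-- The additive functional `A_t = ∫_0^t f(X_s) ds`. -/
noncomputable def additiveFunctional (M : MarkovJumpProcess Ω E) (f : E → ℝ) (t : ℝ) (ω : Ω) : ℝ :=
  ∫ s in (0 : ℝ)..t, f (M.X s.toNNReal ω)

theorem integrable_comp (M : MarkovJumpProcess Ω E) (g : E → ℝ) (t : ℝ≥0) (x : E) :
    Integrable (fun ω => g (M.X t ω)) (M.P x) := by
  have := M.isProbabilityMeasure x
  refine Integrable.of_bound ((measurable_of_finite g).comp (M.measurable_X t)).aestronglyMeasurable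
    ‖g‖ (ae_of_all _ fun ω => norm_le_pi_norm g _)

/-- The Markov semigroup `(P_t g)(x) = E_x[g(X_t)]`. -/
noncomputable def semigroup (M : MarkovJumpProcess Ω E) (t : ℝ≥0) : (E → ℝ) →ₗ[ℝ] (E → ℝ) where
  toFun g x := ∫ ω, g (M.X t ω) ∂(M.P x)
  map_add' g h := by
    ext x
    exact integral_add (M.integrable_comp g t x) (M.integrable_comp h t x)
  map_smul' c g := by
    ext x
    exact integral_const_mul c _

theorem semigroup_add (M : MarkovJumpProcess Ω E) (s t : ℝ≥0) (g : E → ℝ) :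
    M.semigroup (s + t) g = M.semigroup s (M.semigroup t g) := by
  ext x
  have := M.isProbabilityMeasure x
  have h := M.markov_past x s (fun p => g (p t))
    ((measurable_of_finite g).comp (measurable_pi_apply t)) ⟨‖g‖, fun p => norm_le_pi_norm g _⟩
  have hle : (⨆ r : ℝ≥0, ⨆ _ : r ≤ s, MeasurableSpace.comap (M.X r) inferInstance)
      ≤ (inferInstance : MeasurableSpace Ω) :=
    iSup_le fun r => iSup_le fun _ => (M.measurable_X r).comap_le
  have h1 := integral_congr_ae h
  rw [integral_condExp hle] at h1
  exact h1

theorem semigroup_zero (M : MarkovJumpProcess Ω E) (g : E → ℝ) : M.semigroup 0 g = g := by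
  ext x
  have := M.isProbabilityMeasure x
  have h : ∀ᵐ ω ∂(M.P x), M.X 0 ω = x :=
    (prob_compl_eq_zero_iff (M.measurable_X 0 (MeasurableSet.of_discrete (s := {x})))).2 (M.start x)
  calc ∫ ω, g (M.X 0 ω) ∂(M.P x) = ∫ _, g x ∂(M.P x) :=
        integral_congr_ae (h.mono fun ω hω => by simp [hω])
    _ = g x := by simp

theorem norm_semigroup_le (M : MarkovJumpProcess Ω E) (t : ℝ≥0) (g : E → ℝ) :
    ‖M.semigroup t g‖ ≤ ‖g‖ := by
  refine (pi_norm_le_iff_of_nonneg (norm_nonneg g)).2 fun x => ?_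
  have := M.isProbabilityMeasure x
  have := norm_integral_le_of_norm_le_const (μ := M.P x) (f := fun ω => g (M.X t ω)) (C := ‖g‖)
    (ae_of_all _ fun ω => norm_le_pi_norm g _)
  rw [probReal_univ, mul_one] at this
  exact this

theorem tendsto_semigroup (M : MarkovJumpProcess Ω E) (g : E → ℝ) :
    Tendsto (fun h => M.semigroup h g) (𝓝[>] 0) (𝓝 g) := by
  rw [tendsto_pi_nhds]
  intro x
  have := M.isProbabilityMeasure x
  have key : Tendsto (fun h => ∫ ω, g (M.X h ω) ∂(M.P x)) (𝓝[>] (0 : ℝ≥0))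
      (𝓝 (∫ ω, g (M.X 0 ω) ∂(M.P x))) := by
    refine tendsto_integral_filter_of_dominated_convergence (fun _ => ‖g‖)
      (Eventually.of_forall fun h => (M.integrable_comp g h x).aestronglyMeasurable)
      (Eventually.of_forall fun h => ae_of_all _ fun ω => norm_le_pi_norm g _)
      (integrable_const _) (ae_of_all _ fun ω => ?_)
    obtain ⟨ε, hε, hX⟩ := M.jump ω 0
    refine tendsto_const_nhds.congr' ?_
    filter_upwards [nhdsWithin_le_nhds (Iic_mem_nhds hε)] with h hh
    rw [← hX h hh, zero_add]
  have h0 := congrFun (M.semigroup_zero g) x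
  rw [← h0]
  exact key

theorem exists_generator (M : MarkovJumpProcess Ω E) (g : E → ℝ) :
    ∃ v : E → ℝ, Tendsto (fun h : ℝ≥0 => (h : ℝ)⁻¹ • (M.semigroup h g - g)) (𝓝[>] 0) (𝓝 v) := by
  let T : ℝ≥0 → ((E → ℝ) →L[ℝ] (E → ℝ)) := fun t => LinearMap.toContinuousLinearMap (M.semigroup t)
  have hT : ∀ t g, T t g = M.semigroup t g := fun t g => rfl
  have hlim : Tendsto T (𝓝[>] 0) (𝓝 1) := by
    classical
    let b := Pi.basisFun ℝ E
    let e : ((E → ℝ) →L[ℝ] (E → ℝ)) ≃ₗ[ℝ] (E → (E → ℝ)) :=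
      LinearMap.toContinuousLinearMap.symm.trans (b.constr ℝ).symm
    have hc : Continuous e.symm := LinearMap.continuous_of_finiteDimensional e.symm.toLinearMap
    have ht : Tendsto (fun t => e (T t)) (𝓝[>] 0) (𝓝 (e 1)) := by
      rw [tendsto_pi_nhds]
      intro i
      have : Tendsto (fun t => M.semigroup t (b i)) (𝓝[>] 0) (𝓝 (b i)) := M.tendsto_semigroup _
      exact this
    have := (hc.tendsto (e 1)).comp ht
    simpa [Function.comp_def] using this
  obtain ⟨a, ha⟩ := exists_semigroup_deriv T
    (ContinuousLinearMap.ext fun g => M.semigroup_zero g)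
    (fun s t => ContinuousLinearMap.ext fun g => M.semigroup_add s t g) 1
    (fun t => ContinuousLinearMap.opNorm_le_bound _ zero_le_one fun g => by
      rw [one_mul]; exact M.norm_semigroup_le t g) hlim
  refine ⟨a g, ?_⟩
  exact ((ContinuousLinearMap.apply ℝ (E → ℝ) g).continuous.tendsto a).comp ha

/-- The infinitesimal generator `L g = lim_{h ↓ 0} (P_h g - g) / h`, which is defined on all
functions because the state space is finite. -/
noncomputable def generator (M : MarkovJumpProcess Ω E) : (E → ℝ) →ₗ[ℝ] (E → ℝ) where
  toFun g := limUnder (𝓝[>] (0 : ℝ≥0)) fun h : ℝ≥0 => (h : ℝ)⁻¹ • (M.semigroup h g - g)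
  map_add' g k := by
    refine Tendsto.limUnder_eq ?_
    refine ((tendsto_nhds_limUnder (M.exists_generator g)).add
      (tendsto_nhds_limUnder (M.exists_generator k))).congr fun h => ?_
    rw [map_add, ← smul_add]
    congr 1
    abel
  map_smul' c g := by
    refine Tendsto.limUnder_eq ?_
    refine ((tendsto_nhds_limUnder (M.exists_generator g)).const_smul c).congr fun h => ?_
    rw [map_smul, smul_comm, ← smul_sub]

theorem tendsto_generator (M : MarkovJumpProcess Ω E) (g : E → ℝ) :
    Tendsto (fun h : ℝ≥0 => (h : ℝ)⁻¹ • (M.semigroup h g - g)) (𝓝[>] 0) (𝓝 (M.generator g)) :=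
  tendsto_nhds_limUnder (M.exists_generator g)

end MarkovJumpProcess

namespace WeightedL2

variable {E : Type*} [Fintype E]

/-- The inner product of `L²(π)`. -/
noncomputable def ip (π g h : E → ℝ) : ℝ := ∑ x, π x * (g x * h x)

/-- The norm of `L²(π)`. -/
noncomputable def norm2 (π g : E → ℝ) : ℝ := Real.sqrt (ip π g g)

open Classical in
/-- The adjoint in `L²(π)` of an operator, for `π` with strictly positive weights; its value
`(A* g)(x)` is `⟨A e_x, g⟩ / π_x`, with `e_x` the indicator function of `x`. -/
noncomputable def adjoint (π : E → ℝ) (A : (E → ℝ) →ₗ[ℝ] (E → ℝ)) : (E → ℝ) →ₗ[ℝ] (E → ℝ) where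
  toFun g x := (π x)⁻¹ * ip π (A fun y => if x = y then 1 else 0) g
  map_add' g h := by
    ext x
    simp only [ip, Pi.add_apply, mul_add, Finset.sum_add_distrib]
  map_smul' c g := by
    ext x
    simp only [ip, Pi.smul_apply, smul_eq_mul, RingHom.id_apply, Finset.mul_sum]
    exact Finset.sum_congr rfl fun y _ => by ring

theorem ip_adjoint (π : E → ℝ) (hπ : ∀ x, 0 < π x) (A : (E → ℝ) →ₗ[ℝ] (E → ℝ)) (g h : E → ℝ) :
    ip π (A g) h = ip π g (adjoint π A h) := by
  classical
  have hg : ∀ y, A g y = ∑ x, g x * A (fun y => if x = y then 1 else 0) y := by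
    intro y
    rw [LinearMap.pi_apply_eq_sum_univ A g]
    simp [Finset.sum_apply]
  have hx : ∀ x, π x * (g x * adjoint π A h x)
      = g x * ip π (A fun y => if x = y then 1 else 0) h := by
    intro x
    have := (hπ x).ne'
    change π x * (g x * ((π x)⁻¹ * ip π (A fun y => if x = y then 1 else 0) h)) = _
    field_simp
  unfold ip at hx ⊢
  rw [Finset.sum_congr rfl fun x _ => hx x]
  simp only [hg, Finset.sum_mul, Finset.mul_sum]
  rw [Finset.sum_comm]
  exact Finset.sum_congr rfl fun x _ => Finset.sum_congr rfl fun y _ => by ring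

/-- The symmetrisation `(A + A*) / 2` in `L²(π)`. -/
noncomputable def symPart (π : E → ℝ) (A : (E → ℝ) →ₗ[ℝ] (E → ℝ)) : Module.End ℝ (E → ℝ) :=
  (1 / 2 : ℝ) • (A + adjoint π A)

/-- Multiplication by `f`. -/
def mulOp (f : E → ℝ) : Module.End ℝ (E → ℝ) := LinearMap.mulLeft ℝ f

end WeightedL2

section ReducedResolvent

variable {V : Type*} [AddCommGroup V] [Module ℝ V]

/-- The sum of the eigenspaces of `T` for the eigenvalues other than `lam`; for diagonalizable `T`
this is the image of `1 - pr_lam`, with `pr_lam` the eigenprojection. -/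
def otherEigenspaces (T : Module.End ℝ V) (lam : ℝ) : Submodule ℝ V :=
  ⨆ μ : ℝ, ⨆ _ : μ ≠ lam, T.eigenspace μ

theorem mem_otherEigenspaces (T : Module.End ℝ V) (lam : ℝ) :
    ∀ v ∈ otherEigenspaces T lam, (T - lam • (1 : Module.End ℝ V)) v ∈ otherEigenspaces T lam := by
  intro v hv
  have : otherEigenspaces T lam ≤
      (otherEigenspaces T lam).comap (T - lam • (1 : Module.End ℝ V)) := by
    refine iSup_le fun μ => iSup_le fun hμ => fun w hw => ?_
    have hle : T.eigenspace μ ≤ otherEigenspaces T lam :=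
      le_iSup₂_of_le (f := fun (ν : ℝ) (_ : ν ≠ lam) => T.eigenspace ν) μ hμ le_rfl
    have e : (T - lam • (1 : Module.End ℝ V)) w = (μ - lam) • w := by
      simp [Module.End.mem_eigenspace_iff.1 hw, sub_smul]
    rw [Submodule.mem_comap, e]
    exact Submodule.smul_mem _ _ (hle hw)
  exact this hv

theorem injective_restrict_otherEigenspaces (T : Module.End ℝ V) (lam : ℝ) :
    Function.Injective
      ((T - lam • (1 : Module.End ℝ V)).restrict (mem_otherEigenspaces T lam)) := by
  rw [← LinearMap.ker_eq_bot, LinearMap.ker_eq_bot']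
  rintro ⟨v, hv⟩ h
  have h1 : (T - lam • (1 : Module.End ℝ V)) v = 0 := congrArg Subtype.val h
  have h2 : v ∈ T.eigenspace lam := by
    rw [Module.End.mem_eigenspace_iff]
    simpa [sub_eq_zero] using h1
  have h3 := (Submodule.disjoint_def.1 (T.eigenspaces_iSupIndep lam)) v h2 hv
  exact Subtype.ext h3

open Classical in
/-- The reduced resolvent of a diagonalizable operator `T` with respect to `lam`: it is the inverse
of `T - lam` on `Im (1 - pr_lam)` and it is zero on `Im pr_lam = Ker (T - lam)`. (Operators for
which `V` is not the direct sum of these two spaces are not diagonalizable, and get `0`.) -/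
noncomputable def reducedResolvent [FiniteDimensional ℝ V] (T : Module.End ℝ V) (lam : ℝ) : Module.End ℝ V :=
  if h : IsCompl (otherEigenspaces T lam) (T.eigenspace lam) then
    (otherEigenspaces T lam).subtype ∘ₗ
      (LinearEquiv.ofInjectiveEndo _ (injective_restrict_otherEigenspaces T lam)).symm.toLinearMap ∘ₗ
      (otherEigenspaces T lam).projectionOnto (T.eigenspace lam) h
  else 0

end ReducedResolvent

namespace MarkovJumpProcess

variable {Ω E : Type*} [MeasurableSpace Ω] [Fintype E] [MeasurableSpace E]
  [DiscreteMeasurableSpace E]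

/-- The symmetrised generator `(L + L*) / 2` in `L²(π)`. -/
noncomputable def symGenerator (M : MarkovJumpProcess Ω E) (π : E → ℝ) : Module.End ℝ (E → ℝ) :=
  WeightedL2.symPart π M.generator

/-- The spectral gap: the least absolute value of a nonzero element of the (finite) spectrum of
`(L + L*) / 2`. -/
noncomputable def spectralGap (M : MarkovJumpProcess Ω E) (π : E → ℝ) : ℝ :=
  sInf ((fun μ : ℝ => |μ|) '' (spectrum ℝ (M.symGenerator π) \ {0}))

/-- The variance parameter `-2 ⟨f, S f⟩`, with `S` the reduced resolvent of `(L + L*) / 2` with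
respect to the eigenvalue `0`. -/
noncomputable def sigmaHatSq (M : MarkovJumpProcess Ω E) (π f : E → ℝ) : ℝ :=
  -2 * WeightedL2.ip π f (reducedResolvent (M.symGenerator π) 0 f)

/-- The largest eigenvalue of `(L + L*) / 2 + r M_f`, with `M_f` the multiplication by `f`. -/
noncomputable def topEigenvalue (M : MarkovJumpProcess Ω E) (π f : E → ℝ) (r : ℝ) : ℝ :=
  sSup (spectrum ℝ (M.symGenerator π + r • WeightedL2.mulOp f))

end MarkovJumpProcess

/-! Chernoff's inequality reduces the tail bound to exponential moments of $A_t$, and these are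
controlled by the quadratic form of $L+rM_f$, in which only the symmetric part of $L$ is visible. So
one estimate, `ip_apply_add_mul_le`, yields both the tail bound and the eigenvalue bound.

Let $T=(L+L^*)/2$, $w=Sf$, so that $Tw=f$. Split $g=a+h$ into its mean and a mean-zero part, and put
$D=-\langle Th,h\rangle$. Then $\langle Tg,g\rangle+r\langle fg,g\rangle=-D+2ar\langle
f,h\rangle+r\langle fh,h\rangle$. The spectral gap bounds the last term by
$r\frac{\|f^+\|_\infty}{\lambda_1}D$; Cauchy-Schwarz for the form of $-T$ gives $\langle
f,h\rangle^2\le-\langle f,w\rangle D$, where $-\langle f,w\rangle=\hat\sigma_f^2/2$. Young's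
inequality then absorbs $D$ and leaves $\Lambda a^2\le\Lambda\langle g,g\rangle$, with $\Lambda$ the
asserted bound on $\lambda_0(r)$. Irreducibility enters through the kernel of $T$: it consists of
the constants, so $S$ inverts $T$ on mean-zero functions.

The exponential moments are handled in discrete time. For Riemann sums of $A_t$ with step $h$, the
Markov property writes the moment as $\langle d\nu/d\pi,T_h^n1\rangle$ with $T_hg=P_h(e^{rhf}g)$
(`integral_prod_eq_tilted_pow`). Since $T_h$ has right derivative $L+rM_f$ at $0$, its $L^2(\pi)$
norm is at most $e^{h(\Lambda+\varepsilon)}$ for small $h$ (`eventually_ip_apply_le`). Letting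
$h\to0$ and then $\varepsilon\to0$ gives $\|d\nu/d\pi\|_2e^{t\Lambda}$, and
`exists_bernstein_exponent` picks the optimal $r$. -/

set_option linter.unusedSectionVars false

/-- An operator that is symmetric for an inner product has an orthonormal eigenbasis. -/
theorem exists_orthonormal_eigenbasis_of_core {V : Type*} [AddCommGroup V] [Module ℝ V]
    [FiniteDimensional ℝ V] (c : InnerProductSpace.Core ℝ V) (T : Module.End ℝ V)
    (hT : ∀ v w, c.inner (T v) w = c.inner v (T w)) :
    ∃ (b : Module.Basis (Fin (Module.finrank ℝ V)) ℝ V) (μ : Fin (Module.finrank ℝ V) → ℝ),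
      (∀ i j, c.inner (b i) (b j) = if i = j then 1 else 0) ∧ ∀ i, T (b i) = μ i • b i := by
  let _ : NormedAddCommGroup V := c.toNormedAddCommGroup
  let _ : InnerProductSpace ℝ V := InnerProductSpace.ofCore c.toCore
  have hs : T.IsSymmetric := hT
  refine ⟨(hs.eigenvectorBasis rfl).toBasis, hs.eigenvalues rfl, fun i j => ?_, fun i => ?_⟩
  · simpa using orthonormal_iff_ite.1 (hs.eigenvectorBasis rfl).orthonormal i j
  · simp [hs.apply_eigenvectorBasis rfl i]

/-! ### The inner product of $L^2(\pi)$ and symmetric operators -/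

namespace WeightedL2

variable {E : Type*} [Fintype E]

theorem ip_comm (π g h : E → ℝ) : ip π g h = ip π h g :=
  Finset.sum_congr rfl fun x _ => by ring

theorem ip_add_left (π g h k : E → ℝ) : ip π (g + h) k = ip π g k + ip π h k := by
  simp only [ip, ← Finset.sum_add_distrib]
  exact Finset.sum_congr rfl fun x _ => by simp only [Pi.add_apply]; ring

theorem ip_smul_left (π : E → ℝ) (a : ℝ) (g h : E → ℝ) : ip π (a • g) h = a * ip π g h := by
  simp only [ip, Finset.mul_sum]
  exact Finset.sum_congr rfl fun x _ => by simp only [Pi.smul_apply, smul_eq_mul]; ring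

theorem ip_add_right (π g h k : E → ℝ) : ip π g (h + k) = ip π g h + ip π g k := by
  rw [ip_comm, ip_add_left, ip_comm π h, ip_comm π k]

theorem ip_smul_right (π : E → ℝ) (a : ℝ) (g h : E → ℝ) : ip π g (a • h) = a * ip π g h := by
  rw [ip_comm, ip_smul_left, ip_comm]

theorem ip_sum_left {ι : Type*} (s : Finset ι) (π : E → ℝ) (g : ι → E → ℝ) (h : E → ℝ) :
    ip π (∑ i ∈ s, g i) h = ∑ i ∈ s, ip π (g i) h := by
  simp only [ip, Finset.sum_apply, Finset.sum_mul, Finset.mul_sum]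
  exact Finset.sum_comm

theorem ip_self_nonneg {π : E → ℝ} (hπ : ∀ x, 0 < π x) (g : E → ℝ) : 0 ≤ ip π g g :=
  Finset.sum_nonneg fun x _ => mul_nonneg (hπ x).le (mul_self_nonneg _)

theorem eq_zero_of_ip_self {π : E → ℝ} (hπ : ∀ x, 0 < π x) {g : E → ℝ} (h : ip π g g = 0) :
    g = 0 := by
  ext x
  have := (Finset.sum_eq_zero_iff_of_nonneg
    fun y _ => mul_nonneg (hπ y).le (mul_self_nonneg (g y))).1 h x (Finset.mem_univ x)
  simpa [(hπ x).ne'] using this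

/-- Cauchy-Schwarz for a positive semidefinite symmetric bilinear form `⟨A g, h⟩`. -/
theorem ip_apply_sq_le (π : E → ℝ) (A : Module.End ℝ (E → ℝ))
    (hA : ∀ g h, ip π (A g) h = ip π g (A h)) (hpos : ∀ g, 0 ≤ ip π (A g) g) (g h : E → ℝ) :
    ip π (A g) h ^ 2 ≤ ip π (A g) g * ip π (A h) h := by
  have key : ∀ s : ℝ,
      0 ≤ ip π (A h) h * (s * s) + 2 * ip π (A g) h * s + ip π (A g) g := by
    intro s
    have := hpos (g + s • h)
    have e : ip π (A h) g = ip π (A g) h := by rw [hA, ip_comm]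
    simp only [map_add, map_smul, ip_add_left, ip_add_right, ip_smul_left, ip_smul_right, e] at this
    linarith
  have := discrim_le_zero key
  rw [discrim] at this
  linarith

theorem ip_le_norm2_mul {π : E → ℝ} (hπ : ∀ x, 0 < π x) (g h : E → ℝ) :
    ip π g h ≤ norm2 π g * norm2 π h := by
  rw [norm2, norm2, ← Real.sqrt_mul (ip_self_nonneg hπ g)]
  exact Real.le_sqrt_of_sq_le
    (ip_apply_sq_le π 1 (fun _ _ => rfl) (fun g => ip_self_nonneg hπ g) g h)

/-- The spectral theorem is invoked through an abstract space because `E → ℝ` already carries the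
sup norm, with which the norm of $L^2(\pi)$ would clash. -/
theorem exists_orthonormal_eigenbasis {π : E → ℝ} (hπ : ∀ x, 0 < π x) (T : Module.End ℝ (E → ℝ))
    (hT : ∀ g h, ip π (T g) h = ip π g (T h)) :
    ∃ (n : ℕ) (b : Module.Basis (Fin n) ℝ (E → ℝ)) (μ : Fin n → ℝ),
      (∀ i j, ip π (b i) (b j) = if i = j then 1 else 0) ∧ ∀ i, T (b i) = μ i • b i := by
  let c : InnerProductSpace.Core ℝ (E → ℝ) :=
    { inner := ip π
      conj_inner_symm := fun g h => ip_comm π h g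
      re_inner_nonneg := fun g => ip_self_nonneg hπ g
      add_left := fun g h k => ip_add_left π g h k
      smul_left := fun g h a => ip_smul_left π a g h
      definite := fun g hg => eq_zero_of_ip_self hπ hg }
  exact ⟨_, exists_orthonormal_eigenbasis_of_core c T hT⟩

theorem ip_symPart_left {π : E → ℝ} (hπ : ∀ x, 0 < π x) (A : Module.End ℝ (E → ℝ))
    (g h : E → ℝ) : ip π (symPart π A g) h = (ip π (A g) h + ip π g (A h)) / 2 := by
  have e : ip π (adjoint π A g) h = ip π g (A h) := by
    rw [ip_comm, ← ip_adjoint π hπ, ip_comm]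
  rw [symPart, LinearMap.smul_apply, LinearMap.add_apply, ip_smul_left, ip_add_left, e]
  ring

theorem symPart_symmetric {π : E → ℝ} (hπ : ∀ x, 0 < π x) (A : Module.End ℝ (E → ℝ))
    (g h : E → ℝ) : ip π (symPart π A g) h = ip π g (symPart π A h) := by
  rw [ip_comm π g, ip_symPart_left hπ, ip_symPart_left hπ, ip_comm π (A h), ip_comm π h]
  ring

end WeightedL2

/-! ### The reduced resolvent as an inverse -/

section ReducedResolvent

variable {V : Type*} [AddCommGroup V] [Module ℝ V] [FiniteDimensional ℝ V]

/-- Diagonalizability makes the eigenspace of `lam` and the sum of the others complementary, which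
excludes the default value `0` in the definition of the reduced resolvent. -/
theorem apply_reducedResolvent {T : Module.End ℝ V} {lam : ℝ} (hT : ⨆ μ, T.eigenspace μ = ⊤) {v : V}
    (hv : v ∈ otherEigenspaces T lam) :
    (T - lam • (1 : Module.End ℝ V)) (reducedResolvent T lam v) = v := by
  have hc : IsCompl (otherEigenspaces T lam) (T.eigenspace lam) := by
    refine ⟨(T.eigenspaces_iSupIndep lam).symm, codisjoint_iff.2 (top_le_iff.1 ?_)⟩
    rw [← hT]
    refine iSup_le fun μ => ?_
    by_cases h : μ = lam
    · rw [h]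
      exact le_sup_right
    · exact le_trans (le_iSup₂_of_le (f := fun (ν : ℝ) (_ : ν ≠ lam) => T.eigenspace ν) μ h le_rfl)
        le_sup_left
  rw [reducedResolvent, dif_pos hc]
  have e := LinearEquiv.apply_symm_apply
    (LinearEquiv.ofInjectiveEndo _ (injective_restrict_otherEigenspaces T lam)) ⟨v, hv⟩
  have e2 := congrArg Subtype.val e
  have e3 : (otherEigenspaces T lam).projectionOnto (T.eigenspace lam) hc v = ⟨v, hv⟩ :=
    Submodule.projectionOnto_apply_left hc ⟨v, hv⟩
  simp only [LinearMap.comp_apply, e3]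
  exact e2

end ReducedResolvent

/-! ### Spectral gap and the variational estimate -/

namespace WeightedL2

variable {E : Type*} [Fintype E]

theorem ip_const_left (π g : E → ℝ) (c : ℝ) : ip π (fun _ => c) g = c * ∑ x, π x * g x := by
  simp only [ip, Finset.mul_sum]
  exact Finset.sum_congr rfl fun x _ => by ring

section Symmetric

variable {π : E → ℝ} {T : Module.End ℝ (E → ℝ)}

theorem iSup_eigenspace_eq_top (hπ : ∀ x, 0 < π x) (hT : ∀ g h, ip π (T g) h = ip π g (T h)) :
    ⨆ μ, T.eigenspace μ = ⊤ := by
  obtain ⟨n, b, μ, -, hb⟩ := exists_orthonormal_eigenbasis hπ T hT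
  rw [← top_le_iff, ← b.span_eq, Submodule.span_le]
  rintro _ ⟨i, rfl⟩
  exact Submodule.mem_iSup_of_mem (μ i) (Module.End.mem_eigenspace_iff.2 (hb i))

/-- In an orthonormal eigenbasis the null eigenvectors are constants, and a mean-zero function is
orthogonal to these, so only the other eigenvectors contribute to it. -/
theorem mem_otherEigenspaces_zero (hπ : ∀ x, 0 < π x) (hT : ∀ g h, ip π (T g) h = ip π g (T h))
    (hker : ∀ g, T g = 0 → ∃ c : ℝ, g = fun _ => c) {f : E → ℝ} (hf : ∑ x, π x * f x = 0) :
    f ∈ otherEigenspaces T 0 := by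
  obtain ⟨n, b, μ, ho, hb⟩ := exists_orthonormal_eigenbasis hπ T hT
  rw [← b.sum_repr f]
  refine Submodule.sum_mem _ fun i _ => ?_
  by_cases hi : μ i = 0
  · have h0 : b.repr f i = ip π (b i) f := by
      conv_rhs => rw [← b.sum_repr f, ip_comm, ip_sum_left]
      simp [ip_smul_left, ho]
    obtain ⟨c, hc⟩ := hker (b i) (by rw [hb, hi, zero_smul])
    rw [h0, hc, ip_const_left, hf]
    simp
  · exact Submodule.smul_mem _ _ ((le_iSup₂_of_le (f := fun (ν : ℝ) (_ : ν ≠ 0) => T.eigenspace ν)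
      (μ i) hi le_rfl) (Module.End.mem_eigenspace_iff.2 (hb i)))

theorem apply_reducedResolvent_zero (hπ : ∀ x, 0 < π x)
    (hT : ∀ g h, ip π (T g) h = ip π g (T h)) (hker : ∀ g, T g = 0 → ∃ c : ℝ, g = fun _ => c)
    {f : E → ℝ} (hf : ∑ x, π x * f x = 0) : T (reducedResolvent T 0 f) = f := by
  simpa using apply_reducedResolvent (iSup_eigenspace_eq_top hπ hT)
    (mem_otherEigenspaces_zero hπ hT hker hf)

/-- Cauchy-Schwarz for the form of $-T$ at $g$ and $Tg$ gives $\langle Tg,Tg\rangle^2\le0$. -/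
theorem apply_eq_zero_of_ip (hT : ∀ g h, ip π (T g) h = ip π g (T h))
    (hneg : ∀ g, ip π (T g) g ≤ 0) (hπ : ∀ x, 0 < π x) {g : E → ℝ} (hg : ip π (T g) g = 0) :
    T g = 0 := by
  have hn : ∀ g h, ip π ((-T) g) h = -ip π (T g) h := fun g h => by
    rw [LinearMap.neg_apply, ← neg_one_smul ℝ, ip_smul_left, neg_one_mul]
  have := ip_apply_sq_le π (-T) (fun g h => by rw [hn, hT, ip_comm, ip_comm π g, hn])
    (fun g => by rw [hn]; linarith [hneg g]) g (T g)
  rw [hn g g, hg, hn g] at this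
  refine eq_zero_of_ip_self hπ ?_
  nlinarith [ip_self_nonneg hπ (T g)]

/-- With $w=Sf$ the quantity is $\langle Tw,w\rangle\le0$, and equality would force $f=Tw=0$. This
is the positivity of $\hat\sigma_f^2$. -/
theorem ip_reducedResolvent_neg (hπ : ∀ x, 0 < π x)
    (hT : ∀ g h, ip π (T g) h = ip π g (T h)) (hneg : ∀ g, ip π (T g) g ≤ 0)
    (hker : ∀ g, T g = 0 → ∃ c : ℝ, g = fun _ => c) {f : E → ℝ} (hf0 : f ≠ 0)
    (hf : ∑ x, π x * f x = 0) : ip π f (reducedResolvent T 0 f) < 0 := by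
  have e := apply_reducedResolvent_zero hπ hT hker hf
  have h1 := hneg (reducedResolvent T 0 f)
  rw [e] at h1
  refine lt_of_le_of_ne h1 fun h => hf0 ?_
  rw [← e]
  exact apply_eq_zero_of_ip hT hneg hπ (by rw [e, h])

/-- The spectral gap inequality of a symmetric negative semidefinite operator whose kernel consists
of constants. -/
theorem gap_pos_and_gap_mul_ip_le (hπ : ∀ x, 0 < π x)
    (hT : ∀ g h, ip π (T g) h = ip π g (T h)) (hneg : ∀ g, ip π (T g) g ≤ 0)
    (hker : ∀ g, T g = 0 → ∃ c : ℝ, g = fun _ => c) {f : E → ℝ} (hf0 : f ≠ 0)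
    (hf : ∑ x, π x * f x = 0) :
    0 < sInf ((fun μ : ℝ => |μ|) '' (spectrum ℝ T \ {0})) ∧ ∀ h : E → ℝ, ∑ x, π x * h x = 0 →
      sInf ((fun μ : ℝ => |μ|) '' (spectrum ℝ T \ {0})) * ip π h h ≤ -ip π (T h) h := by
  obtain ⟨n, b, μ, ho, hb⟩ := exists_orthonormal_eigenbasis hπ T hT
  have hspec : ∀ i, μ i ∈ spectrum ℝ T := fun i =>
    (Module.End.hasEigenvalue_of_hasEigenvector
      ⟨Module.End.mem_eigenspace_iff.2 (hb i), b.ne_zero i⟩).mem_spectrum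
  have hμ : ∀ i, μ i ≤ 0 := fun i => by
    have := hneg (b i)
    rwa [hb, ip_smul_left, ho, if_pos rfl, mul_one] at this
  have hcoef : ∀ h i, b.repr h i = ip π (b i) h := fun h i => by
    conv_rhs => rw [← b.sum_repr h, ip_comm, ip_sum_left]
    simp [ip_smul_left, ho]
  have hzero : ∀ h : E → ℝ, ∑ x, π x * h x = 0 → ∀ i, μ i = 0 → b.repr h i = 0 := by
    intro h hh i hi
    obtain ⟨c, hc⟩ := hker (b i) (by rw [hb, hi, zero_smul])
    rw [hcoef, hc, ip_const_left, hh, mul_zero]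
  -- Without a nonzero eigenvalue every coefficient of the mean-zero function `f` would vanish. This
  -- rules out the default value `sInf ∅ = 0`.
  have hne : ((fun μ : ℝ => |μ|) '' (spectrum ℝ T \ {0})).Nonempty := by
    by_contra hcon
    refine hf0 (b.repr.map_eq_zero_iff.1 (Finsupp.ext fun i => hzero f hf i ?_))
    by_contra hi
    exact hcon ⟨_, μ i, ⟨hspec i, hi⟩, rfl⟩
  have hfin : ((fun μ : ℝ => |μ|) '' (spectrum ℝ T \ {0})).Finite :=
    ((Module.End.finite_spectrum T).subset Set.sdiff_subset).image _
  refine ⟨?_, fun h hh => ?_⟩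
  · obtain ⟨ν, hν, e⟩ := hne.csInf_mem hfin
    rw [← e]
    exact abs_pos.2 hν.2
  · set l := sInf ((fun μ : ℝ => |μ|) '' (spectrum ℝ T \ {0}))
    have e1 : ip π h h = ∑ i, b.repr h i * b.repr h i := by
      conv_lhs => enter [2]; rw [← b.sum_repr h]
      rw [ip_sum_left]
      exact Finset.sum_congr rfl fun i _ => by rw [ip_smul_left, hcoef]
    have e2 : ip π (T h) h = ∑ i, μ i * (b.repr h i * b.repr h i) := by
      conv_lhs => enter [2]; rw [← b.sum_repr h, map_sum]
      rw [ip_sum_left]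
      exact Finset.sum_congr rfl fun i _ => by
        rw [map_smul, hb, ip_smul_left, ip_smul_left, hcoef]; ring
    rw [e1, e2, Finset.mul_sum, ← Finset.sum_neg_distrib]
    refine Finset.sum_le_sum fun i _ => ?_
    by_cases hi : μ i = 0
    · simp [hzero h hh i hi]
    · have hl : l ≤ |μ i| := csInf_le hfin.bddBelow ⟨μ i, ⟨hspec i, hi⟩, rfl⟩
      rw [abs_of_nonpos (hμ i)] at hl
      nlinarith [mul_self_nonneg (b.repr h i)]

/-- The variational bound on `⟨T g, g⟩ + r ⟨f g, g⟩`, for `l` a spectral gap of `T` and `K` an upper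
bound of `f`. -/
theorem ip_apply_add_mul_le (hπ : ∀ x, 0 < π x) (hπ1 : ∑ x, π x = 1)
    (hT : ∀ g h, ip π (T g) h = ip π g (T h)) (hneg : ∀ g, ip π (T g) g ≤ 0)
    (hconst : ∀ c : ℝ, T (fun _ => c) = 0) {l K : ℝ} (hl : 0 < l)
    (hgap : ∀ h : E → ℝ, ∑ x, π x * h x = 0 → l * ip π h h ≤ -ip π (T h) h)
    {f w : E → ℝ} (hfK : ∀ x, f x ≤ K) (hK : 0 ≤ K) (hf : ∑ x, π x * f x = 0) (hw : T w = f)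
    {r : ℝ} (hr : 0 ≤ r) (hrK : 0 < 1 - K / l * r) (g : E → ℝ) :
    ip π (T g) g + r * ip π (f * g) g ≤
      r ^ 2 * (-ip π f w) / (1 - K / l * r) * ip π g g := by
  -- Orthogonal splitting into the mean $a$ and a mean-zero part $h$; `T` sees only $h$.
  set a := ∑ x, π x * g x with ha
  set h : E → ℝ := fun x => g x - a with hh
  have hg : g = (fun _ => a) + h := by ext x; simp [hh]
  have hhm : ∑ x, π x * h x = 0 := by
    simp only [hh, mul_sub, Finset.sum_sub_distrib, ← Finset.sum_mul, hπ1, ← ha]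
    ring
  set D := -ip π (T h) h with hD
  have hTg : ip π (T g) g = -D := by
    have h0 : ip π (T h) (fun _ => a) = 0 := by
      rw [hT, hconst, ip]; simp
    rw [hg, map_add, hconst, zero_add, ip_add_right, h0, hD]
    ring
  have hgg : ip π g g = a ^ 2 + ip π h h := by
    have h0 : ip π (fun _ => a) (fun _ => a) = a ^ 2 := by
      rw [ip_const_left, ← Finset.sum_mul, hπ1]; ring
    have h1 : ip π (fun _ => a) h = 0 := by rw [ip_const_left, hhm, mul_zero]
    conv_lhs => rw [hg]
    rw [ip_add_left, ip_add_right, ip_add_right, ip_comm π h (fun _ => a), h0, h1]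
    ring
  have hfg : ip π (f * g) g = 2 * a * ip π f h + ip π (f * h) h := by
    have : ip π (f * g) g = a ^ 2 * ∑ x, π x * f x + (2 * a * ip π f h + ip π (f * h) h) := by
      simp only [ip, Finset.mul_sum, ← Finset.sum_add_distrib]
      exact Finset.sum_congr rfl fun x _ => by simp only [Pi.mul_apply, hh]; ring
    rw [this, hf]; ring
  -- Since $f=Tw$, this is Cauchy-Schwarz for the form of $-T$ at $w$ and $h$.
  have hcs : ip π f h ^ 2 ≤ (-ip π f w) * D := by
    have hn : ∀ g h, ip π ((-T) g) h = -ip π (T g) h := fun g h => by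
      rw [LinearMap.neg_apply, ← neg_one_smul ℝ, ip_smul_left, neg_one_mul]
    have := ip_apply_sq_le π (-T) (fun g h => by rw [hn, hT, ip_comm, ip_comm π g, hn])
      (fun g => by rw [hn]; linarith [hneg g]) w h
    rwa [hn, hn, hn, hw, neg_sq] at this
  have hfh : ip π (f * h) h ≤ K / l * D := by
    have h1 : ip π (f * h) h ≤ K * ip π h h := by
      simp only [ip, Finset.mul_sum]
      refine Finset.sum_le_sum fun x _ => ?_
      have := mul_nonneg (hπ x).le (mul_self_nonneg (h x))
      simp only [Pi.mul_apply]
      nlinarith [hfK x]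
    have h2 : K * ip π h h ≤ K * (D / l) :=
      mul_le_mul_of_nonneg_left ((le_div_iff₀ hl).2 (by linarith [hgap h hhm])) hK
    calc _ ≤ K * (D / l) := h1.trans h2
      _ = K / l * D := by ring
  have hD0 : 0 ≤ D := by rw [hD]; linarith [hneg h]
  have hs0 : 0 ≤ -ip π f w := by
    have := hneg w
    rw [hw] at this
    linarith
  set q := 1 - K / l * r with hq
  set s := -ip π f w
  -- Young's inequality $2\sqrt{XY}\le X+Y$ with $X=r^2sa^2/q$ and $Y=qD$. As the sign of the left
  -- side is unknown, squares are compared, using $(X+Y)^2=(X-Y)^2+4XY$.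
  have main : 2 * a * (r * ip π f h) - q * D ≤ r ^ 2 * s / q * a ^ 2 := by
    rw [div_mul_eq_mul_div, le_div_iff₀ hrK]
    have h3 : (r * ip π f h) ^ 2 * a ^ 2 ≤ r ^ 2 * s * a ^ 2 * D := by
      have := mul_le_mul_of_nonneg_left hcs (mul_nonneg (sq_nonneg r) (sq_nonneg a))
      nlinarith
    have h4 : 0 ≤ r ^ 2 * s * a ^ 2 := by positivity
    have h5 : (2 * a * (r * ip π f h)) ^ 2 ≤ (r ^ 2 * s * a ^ 2 / q + q * D) ^ 2 := by
      have : (r ^ 2 * s * a ^ 2 / q + q * D) ^ 2 =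
          (r ^ 2 * s * a ^ 2 / q - q * D) ^ 2 + 4 * (r ^ 2 * s * a ^ 2 * D) := by
        field_simp
        ring
      rw [this]
      nlinarith [sq_nonneg (r ^ 2 * s * a ^ 2 / q - q * D)]
    have h6 := abs_le_of_sq_le_sq' h5 (by positivity)
    have h7 := mul_le_mul_of_nonneg_right h6.2 hrK.le
    have h8 : (r ^ 2 * s * a ^ 2 / q + q * D) * q = r ^ 2 * s * a ^ 2 + q * D * q := by
      field_simp
    linarith
  have hfin : r ^ 2 * s / q * a ^ 2 ≤ r ^ 2 * s / q * ip π g g := by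
    refine mul_le_mul_of_nonneg_left ?_ (by positivity)
    rw [hgg]
    linarith [ip_self_nonneg hπ h]
  rw [hTg, hfg]
  have := mul_le_mul_of_nonneg_left hfh hr
  have hqD : q * D = D - r * (K / l * D) := by rw [hq]; ring
  linarith

end Symmetric

/-- If `⟨B g, g⟩ ≤ Λ ⟨g, g⟩` then no spectral value of `B` exceeds `Λ`. -/
theorem sSup_spectrum_le {π : E → ℝ} (hπ : ∀ x, 0 < π x) {B : Module.End ℝ (E → ℝ)} {Λ : ℝ}
    (hΛ : 0 ≤ Λ) (hB : ∀ g, ip π (B g) g ≤ Λ * ip π g g) : sSup (spectrum ℝ B) ≤ Λ := by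
  -- `0 ≤ Λ` covers an empty spectrum, whose `sSup` is `0` by convention.
  refine Real.sSup_le (fun μ hμ => ?_) hΛ
  obtain ⟨v, hv⟩ := (Module.End.hasEigenvalue_iff_mem_spectrum.2 hμ).exists_hasEigenvector
  have h := hB v
  rw [hv.apply_eq_smul, ip_smul_left] at h
  refine le_of_mul_le_mul_right h (lt_of_le_of_ne (ip_self_nonneg hπ v) fun h0 => hv.2 ?_)
  exact eq_zero_of_ip_self hπ h0.symm

end WeightedL2

/-! ### Invariant distribution, Dirichlet form and kernel of the generator -/

namespace MarkovJumpProcess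

open WeightedL2

theorem transition_nonneg {Ω E : Type*} [MeasurableSpace Ω] [MeasurableSpace E]
    (M : MarkovJumpProcess Ω E) (t : ℝ≥0) (x y : E) :
    0 ≤ M.transition t x y := measureReal_nonneg

/-- A path that visits `y` stays there for a while, hence is at `y` at a rational time. If all
transition probabilities to `y` vanished, a countable union of null events would contain the hitting
event. -/
theorem exists_transition_pos {Ω E : Type*} [MeasurableSpace Ω] [MeasurableSpace E]
    {M : MarkovJumpProcess Ω E} (hirr : M.IsIrreducible) (x y : E) :
    ∃ t, 0 < M.transition t x y := by
  have := M.isProbabilityMeasure x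
  by_contra! hcon
  have h0 : ∀ t, M.P x {ω | M.X t ω = y} = 0 := fun t => by
    have := le_antisymm (hcon t) (M.transition_nonneg t x y)
    rwa [transition, measureReal_eq_zero_iff] at this
  refine (hirr x y).ne' (measure_mono_null ?_
    (measure_iUnion_null fun q : ℚ => h0 (Real.toNNReal q)))
  rintro ω ⟨t, ht⟩
  obtain ⟨ε, hε, hX⟩ := M.jump ω t
  obtain ⟨q, hq1, hq2⟩ := exists_rat_btwn (show (t : ℝ) < t + ε by simpa using hε)
  have hq0 : (0 : ℝ) ≤ q := t.2.trans hq1.le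
  have htq : t ≤ Real.toNNReal q := by
    rw [← NNReal.coe_le_coe, Real.coe_toNNReal _ hq0]
    exact hq1.le
  refine Set.mem_iUnion.2 ⟨q, ?_⟩
  have h := hX (Real.toNNReal q - t) (by
    rw [tsub_le_iff_left, ← NNReal.coe_le_coe, Real.coe_toNNReal _ hq0]
    exact_mod_cast hq2.le)
  rw [add_tsub_cancel_of_le htq] at h
  exact h.trans ht

variable {Ω E : Type*} [MeasurableSpace Ω] [Fintype E] [MeasurableSpace E]
  [DiscreteMeasurableSpace E]

theorem semigroup_apply_eq_sum (M : MarkovJumpProcess Ω E) (t : ℝ≥0) (g : E → ℝ) (x : E) :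
    M.semigroup t g x = ∑ y, M.transition t x y * g y := by
  classical
  have := M.isProbabilityMeasure x
  have hm : ∀ y, MeasurableSet {ω | M.X t ω = y} := fun y =>
    M.measurable_X t (MeasurableSet.of_discrete (s := {y}))
  have e : ∀ ω, g (M.X t ω) = ∑ y, {ω | M.X t ω = y}.indicator (fun _ => g y) ω := fun ω => by
    simp [Set.indicator_apply]
  change ∫ ω, g (M.X t ω) ∂(M.P x) = _
  simp_rw [e]
  rw [integral_finsetSum _ fun y _ => (integrable_const _).indicator (hm y)]
  exact Finset.sum_congr rfl fun y _ => by rw [integral_indicator_const _ (hm y)]; rfl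

theorem semigroup_const (M : MarkovJumpProcess Ω E) (t : ℝ≥0) (c : ℝ) :
    M.semigroup t (fun _ => c) = fun _ => c := by
  ext x
  have := M.isProbabilityMeasure x
  change ∫ ω, c ∂(M.P x) = c
  simp

theorem IsInvariant.pos {M : MarkovJumpProcess Ω E} (hirr : M.IsIrreducible) {π : E → ℝ}
    (hπ : M.IsInvariant π) (y : E) : 0 < π y := by
  obtain ⟨x, hx⟩ : ∃ x, 0 < π x := by
    by_contra! hcon
    have := Finset.sum_nonpos fun x (_ : x ∈ Finset.univ) => hcon x
    rw [hπ.1.2] at this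
    linarith
  obtain ⟨t, ht⟩ := exists_transition_pos hirr x y
  rw [← hπ.2 t y]
  exact Finset.sum_pos' (fun z _ => mul_nonneg (hπ.1.1 z) (M.transition_nonneg t z y))
    ⟨x, Finset.mem_univ x, mul_pos hx ht⟩

theorem IsInvariant.sum_semigroup {M : MarkovJumpProcess Ω E} {π : E → ℝ}
    (hπ : M.IsInvariant π) (t : ℝ≥0) (g : E → ℝ) :
    ∑ x, π x * M.semigroup t g x = ∑ x, π x * g x := by
  simp_rw [semigroup_apply_eq_sum, Finset.mul_sum]
  rw [Finset.sum_comm]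
  refine Finset.sum_congr rfl fun y _ => ?_
  rw [← hπ.2 t y, Finset.sum_mul]
  exact Finset.sum_congr rfl fun x _ => by ring

theorem generator_const (M : MarkovJumpProcess Ω E) (c : ℝ) : M.generator (fun _ => c) = 0 := by
  refine tendsto_nhds_unique (M.tendsto_generator _) ?_
  simp [semigroup_const]

theorem IsInvariant.sum_generator {M : MarkovJumpProcess Ω E} {π : E → ℝ}
    (hπ : M.IsInvariant π) (g : E → ℝ) : ∑ x, π x * M.generator g x = 0 := by
  have h := tendsto_finsetSum Finset.univ fun x _ =>
    ((tendsto_pi_nhds.1 (M.tendsto_generator g)) x).const_mul (π x)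
  refine tendsto_nhds_unique h (tendsto_const_nhds.congr fun t => ?_)
  have e : ∀ x, π x * ((t : ℝ)⁻¹ • (M.semigroup t g - g)) x =
      (t : ℝ)⁻¹ * (π x * M.semigroup t g x - π x * g x) := fun x => by
    simp only [Pi.smul_apply, Pi.sub_apply, smul_eq_mul]; ring
  simp_rw [e]
  rw [← Finset.mul_sum, Finset.sum_sub_distrib, hπ.sum_semigroup, sub_self, mul_zero]

open Classical in
/-- The jump rate from `x` to `y`. -/
noncomputable def rate (M : MarkovJumpProcess Ω E) (x y : E) : ℝ :=
  M.generator (Pi.single y 1) x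

theorem rate_nonneg (M : MarkovJumpProcess Ω E) {x y : E} (hxy : x ≠ y) : 0 ≤ M.rate x y := by
  classical
  refine ge_of_tendsto' ((tendsto_pi_nhds.1 (M.tendsto_generator (Pi.single y 1))) x) fun t => ?_
  have h1 : 0 ≤ M.semigroup t (Pi.single y 1) x := by
    rw [semigroup_apply_eq_sum]
    exact Finset.sum_nonneg fun z _ => mul_nonneg (M.transition_nonneg t x z) (by
      by_cases h : z = y
      · simp [h]
      · simp [h])
  simp only [Pi.smul_apply, Pi.sub_apply, smul_eq_mul, Pi.single_eq_of_ne hxy, sub_zero]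
  positivity

theorem generator_apply_eq_sum (M : MarkovJumpProcess Ω E) (g : E → ℝ) (x : E) :
    M.generator g x = ∑ y, M.rate x y * g y := by
  classical
  rw [LinearMap.pi_apply_eq_sum_univ M.generator g, Finset.sum_apply]
  refine Finset.sum_congr rfl fun y _ => ?_
  have : (fun j => if y = j then (1 : ℝ) else 0) = Pi.single y 1 := by
    ext j
    simp [Pi.single_apply, eq_comm]
  rw [this, Pi.smul_apply, smul_eq_mul, mul_comm]
  congr

/-- The Dirichlet form in terms of the jump rates. -/
theorem IsInvariant.ip_generator {M : MarkovJumpProcess Ω E} {π : E → ℝ}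
    (hπ : M.IsInvariant π) (g : E → ℝ) :
    -2 * ip π (M.generator g) g = ∑ x, ∑ y, π x * M.rate x y * (g x - g y) ^ 2 := by
  -- On expanding the square, the $g(x)^2$ terms vanish because $L1=0$ and the $g(y)^2$ terms
  -- because $\pi$ is invariant; the cross terms remain.
  have h1 : ∑ x, π x * g x ^ 2 * M.generator (fun _ => 1) x = 0 := by
    simp [generator_const]
  have h2 := hπ.sum_generator fun y => g y ^ 2
  have h3 : ∑ x, ∑ y, π x * M.rate x y * (g x - g y) ^ 2 =
      ∑ x, π x * g x ^ 2 * M.generator (fun _ => 1) x - 2 * ip π (M.generator g) g +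
        ∑ x, π x * M.generator (fun y => g y ^ 2) x := by
    simp only [ip, generator_apply_eq_sum, Finset.mul_sum, Finset.sum_mul]
    rw [← Finset.sum_sub_distrib, ← Finset.sum_add_distrib]
    refine Finset.sum_congr rfl fun x _ => ?_
    rw [← Finset.sum_sub_distrib, ← Finset.sum_add_distrib]
    exact Finset.sum_congr rfl fun y _ => by ring
  rw [h3, h1, h2]
  ring

theorem IsInvariant.ip_generator_nonpos {M : MarkovJumpProcess Ω E} {π : E → ℝ}
    (hπ : M.IsInvariant π) (g : E → ℝ) : ip π (M.generator g) g ≤ 0 := by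
  have : 0 ≤ -2 * ip π (M.generator g) g := by
    rw [hπ.ip_generator]
    refine Finset.sum_nonneg fun x _ => Finset.sum_nonneg fun y _ => ?_
    by_cases h : x = y
    · simp [h]
    · exact mul_nonneg (mul_nonneg (hπ.1.1 x) (M.rate_nonneg h)) (sq_nonneg _)
  linarith

/-- Functions in the kernel of the generator are invariant under the semigroup. -/
theorem semigroup_eq_self (M : MarkovJumpProcess Ω E) {g : E → ℝ} (hg : M.generator g = 0)
    (t : ℝ≥0) : M.semigroup t g = g := by
  rcases eq_or_ne t 0 with rfl | ht
  · exact M.semigroup_zero g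
  -- Telescoping with contractivity. For $h=t/n$ the right side equals $t\,\|(P_hg-g)/h\|$, which
  -- tends to $t\|Lg\|=0$.
  have htel : ∀ (n : ℕ) (h : ℝ≥0), ‖M.semigroup (n * h) g - g‖ ≤ n * ‖M.semigroup h g - g‖ := by
    intro n h
    induction n with
    | zero => simp [semigroup_zero]
    | succ n ih =>
      have e : M.semigroup ((n + 1 : ℕ) * h) g - g =
          M.semigroup (n * h) (M.semigroup h g - g) + (M.semigroup (n * h) g - g) := by
        rw [map_sub, ← semigroup_add]
        push_cast
        rw [add_mul, one_mul]
        abel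
      rw [e]
      push_cast
      linarith [norm_add_le (M.semigroup (n * h) (M.semigroup h g - g))
        (M.semigroup (n * h) g - g), M.norm_semigroup_le (n * h) (M.semigroup h g - g)]
  have hseq : Tendsto (fun n : ℕ => t / (n + 1 : ℕ)) atTop (𝓝[>] 0) := by
    refine tendsto_nhdsWithin_iff.2 ⟨?_, Eventually.of_forall fun n => ?_⟩
    · have := tendsto_const_div_atTop_nhds_zero_nat (t : ℝ)
      rw [← NNReal.tendsto_coe]
      refine Tendsto.congr (fun n => ?_) (this.comp (tendsto_add_atTop_nat 1))
      simp
    · exact div_pos (pos_iff_ne_zero.2 ht) (by positivity)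
  have hlim := ((M.tendsto_generator g).comp hseq).norm.const_mul (t : ℝ)
  rw [hg, norm_zero, mul_zero] at hlim
  have hle : ‖M.semigroup t g - g‖ ≤ 0 := by
    refine ge_of_tendsto' hlim fun n => ?_
    have h := htel (n + 1) (t / (n + 1 : ℕ))
    rw [mul_div_cancel₀ t (by positivity : ((n + 1 : ℕ) : ℝ≥0) ≠ 0)] at h
    refine h.trans (le_of_eq ?_)
    have ht' : (t : ℝ) ≠ 0 := by exact_mod_cast ht
    simp only [Function.comp_apply, norm_smul, norm_inv, Real.norm_eq_abs, NNReal.abs_eq]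
    push_cast
    field_simp
  exact sub_eq_zero.1 (norm_le_zero_iff.1 hle)

/-- A vanishing Dirichlet form forbids jumps between different level sets of `g`. The indicator of a
level set is then fixed by the semigroup, so the process cannot leave its initial level set,
contrary to irreducibility. -/
theorem IsInvariant.eq_const_of_ip_generator {M : MarkovJumpProcess Ω E} (hirr : M.IsIrreducible)
    {π : E → ℝ} (hπ : M.IsInvariant π) {g : E → ℝ} (hg : ip π (M.generator g) g = 0) (x y : E) :
    g x = g y := by
  classical
  have hterm : ∀ x y, 0 ≤ π x * M.rate x y * (g x - g y) ^ 2 := fun x y => by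
    by_cases h : x = y
    · simp [h]
    · exact mul_nonneg (mul_nonneg (hπ.1.1 x) (M.rate_nonneg h)) (sq_nonneg _)
  have hrate : ∀ x y, g x ≠ g y → M.rate x y = 0 := by
    intro x y hxy
    have h := hπ.ip_generator g
    rw [hg, mul_zero] at h
    have h1 := (Finset.sum_eq_zero_iff_of_nonneg
      fun x _ => Finset.sum_nonneg fun y _ => hterm x y).1 h.symm x (Finset.mem_univ x)
    have h2 := (Finset.sum_eq_zero_iff_of_nonneg fun y _ => hterm x y).1 h1 y (Finset.mem_univ y)
    simpa [(hπ.pos hirr x).ne', sub_eq_zero, hxy] using h2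
  set k : E → ℝ := fun z => if g z = g y then 1 else 0 with hk
  have hLk : M.generator k = 0 := by
    ext z
    have h1 : M.generator k z = ∑ w, M.rate z w * k z := by
      rw [generator_apply_eq_sum]
      refine Finset.sum_congr rfl fun w _ => ?_
      by_cases h : g z = g w
      · simp [hk, h]
      · rw [hrate z w h, zero_mul, zero_mul]
    rw [h1, ← Finset.sum_mul]
    have h2 : ∑ w, M.rate z w = M.generator (fun _ => 1) z := by
      rw [generator_apply_eq_sum]; simp
    rw [h2, generator_const]
    simp
  by_contra hxy
  obtain ⟨t, ht⟩ := exists_transition_pos hirr x y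
  have h := congrFun (M.semigroup_eq_self hLk t) x
  rw [semigroup_apply_eq_sum] at h
  have hkx : k x = 0 := by simp [hk, hxy]
  rw [hkx] at h
  have := (Finset.sum_eq_zero_iff_of_nonneg fun z _ => mul_nonneg (M.transition_nonneg t x z) (by
    simp only [hk]; split_ifs <;> norm_num)).1 h y (Finset.mem_univ y)
  simp [hk, ht.ne'] at this

section SymGenerator

variable {M : MarkovJumpProcess Ω E} {π : E → ℝ}

theorem symGenerator_symmetric (hirr : M.IsIrreducible) (hπ : M.IsInvariant π) (g h : E → ℝ) :
    ip π (M.symGenerator π g) h = ip π g (M.symGenerator π h) :=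
  symPart_symmetric (hπ.pos hirr) _ g h

theorem ip_symGenerator_self (hirr : M.IsIrreducible) (hπ : M.IsInvariant π) (g : E → ℝ) :
    ip π (M.symGenerator π g) g = ip π (M.generator g) g := by
  rw [symGenerator, ip_symPart_left (hπ.pos hirr), ip_comm π g]
  ring

theorem ip_symGenerator_nonpos (hirr : M.IsIrreducible) (hπ : M.IsInvariant π) (g : E → ℝ) :
    ip π (M.symGenerator π g) g ≤ 0 := by
  rw [ip_symGenerator_self hirr hπ]
  exact hπ.ip_generator_nonpos g

/-- Constants make the semidefinite form vanish, so they lie in the kernel; $L^*1$ need not be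
computed. -/
theorem symGenerator_const (hirr : M.IsIrreducible) (hπ : M.IsInvariant π) (c : ℝ) :
    M.symGenerator π (fun _ => c) = 0 := by
  refine apply_eq_zero_of_ip (symGenerator_symmetric hirr hπ) (ip_symGenerator_nonpos hirr hπ)
    (hπ.pos hirr) ?_
  rw [ip_symGenerator_self hirr hπ, generator_const]
  simp [ip]

theorem eq_const_of_symGenerator (hirr : M.IsIrreducible) (hπ : M.IsInvariant π) {g : E → ℝ}
    (hg : M.symGenerator π g = 0) : ∃ c : ℝ, g = fun _ => c := by
  have h : ip π (M.generator g) g = 0 := by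
    rw [← ip_symGenerator_self hirr hπ, hg]
    simp [ip]
  rcases isEmpty_or_nonempty E with hE | ⟨⟨y⟩⟩
  · exact ⟨0, Subsingleton.elim _ _⟩
  · exact ⟨g y, funext fun x => hπ.eq_const_of_ip_generator hirr h x y⟩

end SymGenerator

end MarkovJumpProcess

/-! ### Short-time growth of operator families in $L^2(\pi)$ -/

/-- Pointwise convergence of operators on a finite-dimensional function space is convergence in
operator norm. -/
theorem tendsto_toContinuousLinearMap_of_pointwise {E ι : Type*} [Fintype E] {l : Filter ι}
    {T : ι → Module.End ℝ (E → ℝ)} {B : Module.End ℝ (E → ℝ)}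
    (h : ∀ g, Tendsto (fun i => T i g) l (𝓝 (B g))) :
    Tendsto (fun i => LinearMap.toContinuousLinearMap (T i)) l
      (𝓝 (LinearMap.toContinuousLinearMap B)) := by
  classical
  let b := Pi.basisFun ℝ E
  let e : ((E → ℝ) →L[ℝ] (E → ℝ)) ≃ₗ[ℝ] (E → (E → ℝ)) :=
    LinearMap.toContinuousLinearMap.symm.trans (b.constr ℝ).symm
  have hc : Continuous e.symm := LinearMap.continuous_of_finiteDimensional e.symm.toLinearMap
  have ht : Tendsto (fun i => e (LinearMap.toContinuousLinearMap (T i))) l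
      (𝓝 (e (LinearMap.toContinuousLinearMap B))) :=
    tendsto_pi_nhds.2 fun i => h (b i)
  simpa [Function.comp_def] using (hc.tendsto (e (LinearMap.toContinuousLinearMap B))).comp ht

namespace WeightedL2

variable {E : Type*} [Fintype E]

theorem ip_le_norm_mul_norm {π : E → ℝ} (hπ : ∀ x, 0 < π x) (hπ1 : ∑ x, π x = 1) (g h : E → ℝ) :
    ip π g h ≤ ‖g‖ * ‖h‖ := by
  calc ip π g h ≤ ∑ x, π x * (‖g‖ * ‖h‖) := by
        refine Finset.sum_le_sum fun x _ => mul_le_mul_of_nonneg_left ?_ (hπ x).le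
        refine (le_abs_self _).trans ?_
        rw [abs_mul]
        exact mul_le_mul (norm_le_pi_norm g x) (norm_le_pi_norm h x) (abs_nonneg _) (norm_nonneg _)
    _ = ‖g‖ * ‖h‖ := by rw [← Finset.sum_mul, hπ1, one_mul]

theorem exists_mul_norm_sq_le [Nonempty E] {π : E → ℝ} (hπ : ∀ x, 0 < π x) :
    ∃ m : ℝ, 0 < m ∧ ∀ g : E → ℝ, m * ‖g‖ ^ 2 ≤ ip π g g := by
  obtain ⟨z, hz⟩ := Finite.exists_min π
  refine ⟨π z, hπ z, fun g => ?_⟩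
  obtain ⟨x, hx⟩ := Finite.exists_max fun x => |g x|
  have h1 : ‖g‖ ≤ |g x| := (pi_norm_le_iff_of_nonneg (abs_nonneg _)).2 hx
  calc π z * ‖g‖ ^ 2 ≤ π x * |g x| ^ 2 :=
        mul_le_mul (hz x) (pow_le_pow_left₀ (norm_nonneg g) h1 2) (by positivity) (hπ x).le
    _ = π x * (g x * g x) := by rw [sq_abs, sq]
    _ ≤ ip π g g := Finset.single_le_sum (f := fun y => π y * (g y * g y))
        (fun y _ => mul_nonneg (hπ y).le (mul_self_nonneg _)) (Finset.mem_univ x)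

/-- A family of operators with right derivative `B` at `0` grows in `L²(π)` at most with the rate
given by the numerical range of `B`. -/
theorem eventually_ip_apply_le [Nonempty E] {π : E → ℝ} (hπ : ∀ x, 0 < π x) (hπ1 : ∑ x, π x = 1)
    {T : ℝ≥0 → Module.End ℝ (E → ℝ)} {B : Module.End ℝ (E → ℝ)} {Λ ε : ℝ}
    (hT : ∀ g, Tendsto (fun h : ℝ≥0 => (h : ℝ)⁻¹ • (T h g - g)) (𝓝[>] 0) (𝓝 (B g)))
    (hB : ∀ g, ip π (B g) g ≤ Λ * ip π g g) (hε : 0 < ε) :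
    ∀ᶠ h : ℝ≥0 in 𝓝[>] 0, ∀ g,
      ip π (T h g) (T h g) ≤ Real.exp (2 * h * (Λ + ε)) * ip π g g := by
  -- Comparing the sup norm with that of $L^2(\pi)$ makes the error uniform in $g$. With `D h` the
  -- difference quotient, $\langle T_hg,T_hg\rangle=\langle g,g\rangle+2h\langle
  -- D_hg,g\rangle+h^2\langle D_hg,D_hg\rangle$, and $D_h$ is replaced by its limit.
  obtain ⟨m, hm, hmg⟩ := exists_mul_norm_sq_le hπ
  set D : ℝ≥0 → ((E → ℝ) →L[ℝ] (E → ℝ)) := fun h =>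
    LinearMap.toContinuousLinearMap ((h : ℝ)⁻¹ • (T h - 1) : Module.End ℝ (E → ℝ)) with hD
  set C := LinearMap.toContinuousLinearMap B with hC
  have hDC : Tendsto D (𝓝[>] 0) (𝓝 C) := tendsto_toContinuousLinearMap_of_pointwise hT
  have hlim : Tendsto (fun h : ℝ≥0 => 2 * ‖D h - C‖ + h * ‖D h‖ ^ 2) (𝓝[>] 0) (𝓝 0) := by
    have h1 : Tendsto (fun h : ℝ≥0 => (h : ℝ)) (𝓝[>] 0) (𝓝 0) :=
      (NNReal.continuous_coe.tendsto' 0 0 rfl).mono_left nhdsWithin_le_nhds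
    have h2 := (((hDC.sub_const C).norm).const_mul 2).add (h1.mul (hDC.norm.pow 2))
    simpa using h2
  filter_upwards [hlim.eventually (gt_mem_nhds (show 0 < 2 * ε * m by positivity)),
    self_mem_nhdsWithin] with h hh hh0 g
  have hh1 : (0 : ℝ) < h := hh0
  have e : T h g = g + (h : ℝ) • D h g := by
    have : D h g = (h : ℝ)⁻¹ • (T h g - g) := rfl
    rw [this, smul_inv_smul₀ hh1.ne', add_sub_cancel]
  have e2 : ip π (D h g) g = ip π (B g) g + ip π ((D h - C) g) g := by
    have : C g = B g := rfl
    rw [← ip_add_left, ← this, sub_apply, add_sub_cancel]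
  have e3 : ip π (T h g) (T h g) =
      ip π g g + h * (2 * (ip π (B g) g + ip π ((D h - C) g) g) + h * ip π (D h g) (D h g)) := by
    rw [e, ip_add_left, ip_add_right, ip_add_right, ip_smul_left, ip_smul_left, ip_smul_right,
      ip_smul_right, ip_comm π g (D h g), e2]
    ring
  have b1 : ip π ((D h - C) g) g ≤ ‖D h - C‖ * ‖g‖ ^ 2 := by
    refine (ip_le_norm_mul_norm hπ hπ1 _ _).trans ?_
    rw [sq, ← mul_assoc]
    exact mul_le_mul_of_nonneg_right ((D h - C).le_opNorm g) (norm_nonneg g)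
  have b2 : ip π (D h g) (D h g) ≤ ‖D h‖ ^ 2 * ‖g‖ ^ 2 := by
    refine (ip_le_norm_mul_norm hπ hπ1 _ _).trans ?_
    rw [← mul_pow, ← sq]
    exact pow_le_pow_left₀ (norm_nonneg _) ((D h).le_opNorm g) 2
  have b3 : (2 * ‖D h - C‖ + h * ‖D h‖ ^ 2) * ‖g‖ ^ 2 ≤ 2 * ε * ip π g g := by
    calc _ ≤ 2 * ε * m * ‖g‖ ^ 2 := mul_le_mul_of_nonneg_right hh.le (sq_nonneg _)
      _ = 2 * ε * (m * ‖g‖ ^ 2) := by ring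
      _ ≤ _ := mul_le_mul_of_nonneg_left (hmg g) (by positivity)
  have b4 : 2 * (ip π (B g) g + ip π ((D h - C) g) g) + h * ip π (D h g) (D h g) ≤
      2 * (Λ + ε) * ip π g g := by
    have := mul_le_mul_of_nonneg_left b2 hh1.le
    linarith [hB g]
  calc ip π (T h g) (T h g) ≤ ip π g g + h * (2 * (Λ + ε) * ip π g g) := by
        rw [e3]
        linarith [mul_le_mul_of_nonneg_left b4 hh1.le]
    _ = (2 * h * (Λ + ε) + 1) * ip π g g := by ring
    _ ≤ _ := mul_le_mul_of_nonneg_right (Real.add_one_le_exp _) (ip_self_nonneg hπ g)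

end WeightedL2

/-! ### Discrete Feynman-Kac formula and Riemann sums -/

namespace MarkovJumpProcess

open WeightedL2

variable {Ω E : Type*} [MeasurableSpace Ω] [Fintype E] [MeasurableSpace E]
  [DiscreteMeasurableSpace E]

/-- The operator `g ↦ P_h (φ g)`. -/
noncomputable def tilted (M : MarkovJumpProcess Ω E) (φ : E → ℝ) (h : ℝ≥0) :
    Module.End ℝ (E → ℝ) :=
  M.semigroup h ∘ₗ mulOp φ

theorem tilted_apply (M : MarkovJumpProcess Ω E) (φ : E → ℝ) (h : ℝ≥0) (g : E → ℝ) :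
    M.tilted φ h g = M.semigroup h (φ * g) := rfl

/-- Discrete Feynman-Kac formula: conditioning on $X_h$ splits off one factor and restarts the
process, which amounts to one more application of $g\mapsto P_h(\varphi g)$. -/
theorem integral_prod_eq_tilted_pow (M : MarkovJumpProcess Ω E) (φ : E → ℝ) (h : ℝ≥0) (n : ℕ)
    (x : E) :
    ∫ ω, ∏ k ∈ Finset.range n, φ (M.X ((k + 1 : ℕ) * h) ω) ∂(M.P x) =
      (M.tilted φ h ^ n) (fun _ => 1) x := by
  have hφ := measurable_of_finite φ
  induction n generalizing x with
  | zero =>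
    have := M.isProbabilityMeasure x
    simp
  | succ n ih =>
    have hP := M.isProbabilityMeasure
    -- Shifted by `h`, the factor at time `0` becomes the first factor of the product; under `P y`
    -- it is the constant `φ y`.
    let A : (ℝ≥0 → E) → ℝ := fun p => φ (p 0) * ∏ k ∈ Finset.range n, φ (p ((k + 1 : ℕ) * h))
    have hA : Measurable A := by
      refine (hφ.comp (measurable_pi_apply 0)).mul ?_
      exact Finset.measurable_fun_prod _ fun k _ => hφ.comp (measurable_pi_apply _)
    have hAb : ∃ C, ∀ p, |A p| ≤ C := by
      refine ⟨‖φ‖ * ∏ k ∈ Finset.range n, ‖φ‖, fun p => ?_⟩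
      simp only [A, abs_mul, Finset.abs_prod]
      exact mul_le_mul (norm_le_pi_norm φ _) (Finset.prod_le_prod (fun _ _ => abs_nonneg _)
        fun _ _ => norm_le_pi_norm φ _) (Finset.prod_nonneg fun _ _ => abs_nonneg _) (norm_nonneg φ)
    have hle : MeasurableSpace.comap (M.X h) inferInstance ≤ (inferInstance : MeasurableSpace Ω) :=
      (M.measurable_X h).comap_le
    have hmk := integral_congr_ae (M.markov_present x h A hA hAb)
    rw [integral_condExp hle] at hmk
    have hin : ∀ y, ∫ ω, A (fun s => M.X s ω) ∂(M.P y) =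
        φ y * (M.tilted φ h ^ n) (fun _ => 1) y := by
      intro y
      have h0 : ∀ᵐ ω ∂(M.P y), M.X 0 ω = y :=
        (prob_compl_eq_zero_iff
          (M.measurable_X 0 (MeasurableSet.of_discrete (s := {y})))).2 (M.start y)
      rw [← ih y, ← integral_const_mul]
      exact integral_congr_ae (h0.mono fun ω hω => by simp only [A, hω])
    simp_rw [hin] at hmk
    rw [pow_succ', Module.End.mul_apply, tilted_apply]
    refine Eq.trans (integral_congr_ae (ae_of_all _ fun ω => ?_)) hmk
    simp only [A]
    rw [Finset.prod_range_succ', mul_comm, add_zero, zero_add, Nat.cast_one, one_mul]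
    congr 1
    refine Finset.prod_congr rfl fun k _ => ?_
    congr 2
    push_cast
    ring

theorem norm_apply_X_le (M : MarkovJumpProcess Ω E) (f : E → ℝ) (s : ℝ≥0) (ω : Ω) :
    ‖f (M.X s ω)‖ ≤ ‖f‖ := norm_le_pi_norm f _

/-- Write $P_h(e^{rhf}g)-g=(P_hg-g)+P_h((e^{rhf}-1)g)$; contractivity lets the argument of $P_h$
vary with $h$ in the second limit. -/
theorem tendsto_tilted_exp (M : MarkovJumpProcess Ω E) (f : E → ℝ) (r : ℝ) (g : E → ℝ) :
    Tendsto (fun h : ℝ≥0 => (h : ℝ)⁻¹ •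
        (M.tilted (fun x => Real.exp (r * (h * f x))) h g - g)) (𝓝[>] 0)
      (𝓝 ((M.generator + r • mulOp f) g)) := by
  set k : ℝ≥0 → E → ℝ := fun h x => (h : ℝ)⁻¹ * (Real.exp (r * (h * f x)) - 1) * g x with hk
  set k₀ : E → ℝ := r • (f * g) with hk₀
  have hpos : Tendsto (fun h : ℝ≥0 => (h : ℝ)) (𝓝[>] 0) (𝓝[>] 0) := by
    refine tendsto_nhdsWithin_iff.2
      ⟨(NNReal.continuous_coe.tendsto' 0 0 rfl).mono_left nhdsWithin_le_nhds, ?_⟩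
    filter_upwards [self_mem_nhdsWithin] with h hh
    exact NNReal.coe_pos.2 hh
  have hkl : Tendsto k (𝓝[>] 0) (𝓝 k₀) := by
    rw [tendsto_pi_nhds]
    intro x
    have hd : HasDerivAt (fun s : ℝ => Real.exp (r * (s * f x))) (r * f x) 0 := by
      have := (((hasDerivAt_id (0 : ℝ)).mul_const (f x)).const_mul r).exp
      simpa using this
    have h1 := ((hd.tendsto_slope_zero_right).comp hpos).mul_const (g x)
    simpa [hk, hk₀, Function.comp_def, mul_assoc] using h1
  have hPk : Tendsto (fun h => M.semigroup h (k h)) (𝓝[>] 0) (𝓝 k₀) := by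
    have h1 : Tendsto (fun h => M.semigroup h (k h - k₀)) (𝓝[>] 0) (𝓝 0) := by
      refine squeeze_zero_norm (fun h => M.norm_semigroup_le h _) ?_
      simpa using (hkl.sub_const k₀).norm
    have h2 := h1.add (M.tendsto_semigroup k₀)
    rw [zero_add] at h2
    refine h2.congr fun h => ?_
    rw [← map_add, sub_add_cancel]
  refine ((M.tendsto_generator g).add hPk).congr' ?_
  filter_upwards [self_mem_nhdsWithin] with h hh
  have hh' : (h : ℝ) ≠ 0 := (NNReal.coe_pos.2 hh).ne'
  have e : (fun x => Real.exp (r * (h * f x))) * g = g + (h : ℝ) • k h := by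
    ext x
    simp only [hk, Pi.mul_apply, Pi.add_apply, Pi.smul_apply, smul_eq_mul]
    field_simp
    ring
  rw [tilted_apply, e, map_add, map_smul, add_sub_right_comm, smul_add, inv_smul_smul₀ hh']

/-- Right Riemann sums converge to the additive functional. -/
theorem tendsto_riemannSum (M : MarkovJumpProcess Ω E) (f : E → ℝ) {t : ℝ≥0} (ht : 0 < t) (ω : Ω) :
    Tendsto (fun n : ℕ => ∑ k ∈ Finset.range (n + 1),
        (t / (n + 1 : ℕ) : ℝ≥0) * f (M.X ((k + 1 : ℕ) * (t / (n + 1 : ℕ))) ω)) atTop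
      (𝓝 (M.additiveFunctional f t ω)) := by
  set h : ℕ → ℝ≥0 := fun n => t / (n + 1 : ℕ) with hh
  have hpos : ∀ n, (0 : ℝ) < h n := fun n => by
    rw [NNReal.coe_pos]
    exact div_pos ht (by positivity)
  -- The ceiling samples the path at the next grid point to the right of `s`, so right-continuity
  -- makes `F n s` eventually equal to $f(X_s)$.
  set F : ℕ → ℝ → ℝ := fun n s => f (M.X (⌈s / h n⌉₊ * h n) ω) with hF
  have hFm : ∀ n, Measurable (F n) := fun n =>
    (measurable_from_nat (f := fun k : ℕ => f (M.X (k * h n) ω))).comp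
      (Nat.measurable_ceil.comp (measurable_id.div_const _))
  have hFi : ∀ n a b, IntervalIntegrable (F n) volume a b := fun n a b =>
    (intervalIntegrable_const (c := ‖f‖)).mono_fun (hFm n).aestronglyMeasurable
      (ae_of_all _ fun s => (M.norm_apply_X_le f _ ω).trans (le_abs_self _))
  have hsum : ∀ n : ℕ, ∫ s in (0 : ℝ)..t, F n s =
      ∑ k ∈ Finset.range (n + 1), (h n : ℝ) * f (M.X ((k + 1 : ℕ) * h n) ω) := by
    intro n
    have h1 := intervalIntegral.sum_integral_adjacent_intervals (f := F n) (μ := volume)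
      (a := fun k : ℕ => (k : ℝ) * h n) (n := n + 1) fun k _ => hFi n _ _
    have h2 : ((n + 1 : ℕ) : ℝ) * h n = t := by
      simp only [hh]
      push_cast
      field_simp
    rw [h2, Nat.cast_zero, zero_mul] at h1
    rw [← h1]
    refine Finset.sum_congr rfl fun k _ => ?_
    have h3 : ∀ s ∈ Set.uIoc ((k : ℝ) * h n) ((k + 1 : ℕ) * h n),
        F n s = f (M.X ((k + 1 : ℕ) * h n) ω) := by
      intro s hs
      have hle : (k : ℝ) * h n ≤ (k + 1 : ℕ) * h n := by
        push_cast
        nlinarith [hpos n]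
      rw [Set.uIoc_of_le hle] at hs
      have : ⌈s / h n⌉₊ = k + 1 := by
        rw [Nat.ceil_eq_iff (Nat.succ_ne_zero k)]
        refine ⟨?_, ?_⟩
        · rw [lt_div_iff₀ (hpos n)]
          simpa using hs.1
        · rw [div_le_iff₀ (hpos n)]
          exact hs.2
      simp only [hF, this]
    rw [intervalIntegral.integral_congr_ae (ae_of_all _ h3), intervalIntegral.integral_const,
      smul_eq_mul]
    push_cast
    ring
  have hlim : Tendsto (fun n => ∫ s in (0 : ℝ)..t, F n s) atTop
      (𝓝 (M.additiveFunctional f t ω)) := by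
    refine intervalIntegral.tendsto_integral_filter_of_dominated_convergence (fun _ => ‖f‖)
      (Eventually.of_forall fun n => (hFm n).aestronglyMeasurable)
      (Eventually.of_forall fun n => ae_of_all _ fun s _ => M.norm_apply_X_le f _ ω)
      intervalIntegrable_const (ae_of_all _ fun s hs => ?_)
    rw [Set.uIoc_of_le t.coe_nonneg] at hs
    have hs0 : (s.toNNReal : ℝ) = s := Real.coe_toNNReal _ hs.1.le
    obtain ⟨ε, hε, hX⟩ := M.jump ω s.toNNReal
    have hh0 : Tendsto (fun n => (h n : ℝ)) atTop (𝓝 0) := by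
      have := (tendsto_const_div_atTop_nhds_zero_nat (t : ℝ)).comp (tendsto_add_atTop_nat 1)
      exact this.congr fun n => by simp [hh]
    refine tendsto_const_nhds.congr' ?_
    filter_upwards [hh0.eventually (gt_mem_nhds (NNReal.coe_pos.2 hε))] with n hn
    have c1 : s ≤ ⌈s / h n⌉₊ * h n := by
      rw [← div_le_iff₀ (hpos n)]
      exact Nat.le_ceil _
    have c2 : (⌈s / h n⌉₊ : ℝ) * h n < s + h n := by
      have := Nat.ceil_lt_add_one (div_nonneg hs.1.le (hpos n).le)
      calc (⌈s / h n⌉₊ : ℝ) * h n < (s / h n + 1) * h n := mul_lt_mul_of_pos_right this (hpos n)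
        _ = s + h n := by have := (hpos n).ne'; field_simp
    have c3 : s.toNNReal ≤ ⌈s / h n⌉₊ * h n := by
      rw [← NNReal.coe_le_coe, hs0]
      exact_mod_cast c1
    have c4 : (⌈s / h n⌉₊ : ℝ≥0) * h n - s.toNNReal ≤ ε := by
      rw [tsub_le_iff_left, ← NNReal.coe_le_coe]
      push_cast
      rw [hs0]
      linarith
    have := hX _ c4
    rw [add_tsub_cancel_of_le c3] at this
    simp only [hF, this]
  exact hlim.congr hsum

theorem measurable_additiveFunctional (M : MarkovJumpProcess Ω E) (f : E → ℝ) {t : ℝ≥0}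
    (ht : 0 < t) : Measurable (M.additiveFunctional f t) :=
  measurable_of_tendsto_metrizable
    (fun _ => Finset.measurable_fun_sum _ fun _ _ =>
      ((measurable_of_finite f).comp (M.measurable_X _)).const_mul _)
    (tendsto_pi_nhds.2 fun ω => M.tendsto_riemannSum f ht ω)

theorem abs_additiveFunctional_le (M : MarkovJumpProcess Ω E) (f : E → ℝ) (t : ℝ≥0) (ω : Ω) :
    |M.additiveFunctional f t ω| ≤ ‖f‖ * t := by
  have := intervalIntegral.norm_integral_le_of_norm_le_const (a := (0 : ℝ)) (b := t) (C := ‖f‖)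
    (f := fun s => f (M.X s.toNNReal ω)) fun s _ => M.norm_apply_X_le f _ ω
  simpa [additiveFunctional] using this

theorem isProbabilityMeasure_law (M : MarkovJumpProcess Ω E) {ν : E → ℝ}
    (hν : ν ∈ stdSimplex ℝ E) : IsProbabilityMeasure (M.law ν) := by
  have := M.isProbabilityMeasure
  refine ⟨?_⟩
  rw [law, Measure.finsetSum_apply]
  simp only [Measure.smul_apply, measure_univ, smul_eq_mul, mul_one]
  rw [← ENNReal.ofReal_sum_of_nonneg fun x _ => hν.1 x, hν.2, ENNReal.ofReal_one]

theorem integral_law (M : MarkovJumpProcess Ω E) {ν : E → ℝ} (hν : ν ∈ stdSimplex ℝ E) {φ : Ω → ℝ}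
    (hφ : ∀ x, Integrable φ (M.P x)) : ∫ ω, φ ω ∂(M.law ν) = ∑ x, ν x * ∫ ω, φ ω ∂(M.P x) := by
  rw [law, integral_finsetSum_measure fun x _ => (hφ x).smul_measure ENNReal.ofReal_ne_top]
  refine Finset.sum_congr rfl fun x _ => ?_
  rw [integral_smul_measure, ENNReal.toReal_ofReal (hν.1 x), smul_eq_mul]

end MarkovJumpProcess

theorem WeightedL2.ip_pow_apply_le {E : Type*} [Fintype E]
    {π : E → ℝ} {T : Module.End ℝ (E → ℝ)} {a : ℝ}
    (ha : 0 ≤ a) (hT : ∀ g, WeightedL2.ip π (T g) (T g) ≤ a * WeightedL2.ip π g g) (n : ℕ) (g : E → ℝ) :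
    WeightedL2.ip π ((T ^ n) g) ((T ^ n) g) ≤ a ^ n * WeightedL2.ip π g g := by
  induction n with
  | zero => simp
  | succ n ih =>
    rw [pow_succ', Module.End.mul_apply, pow_succ', mul_assoc]
    exact (hT _).trans (mul_le_mul_of_nonneg_left ih ha)

/-! ### Exponential moments of the additive functional -/

namespace MarkovJumpProcess

open WeightedL2

variable {Ω E : Type*} [MeasurableSpace Ω] [Fintype E] [MeasurableSpace E]
  [DiscreteMeasurableSpace E]

theorem integrable_exp_additiveFunctional (M : MarkovJumpProcess Ω E) (f : E → ℝ) (r : ℝ) {t : ℝ≥0}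
    (ht : 0 < t) (μ : Measure Ω) [IsFiniteMeasure μ] :
    Integrable (fun ω => Real.exp (r * M.additiveFunctional f t ω)) μ := by
  refine Integrable.of_bound
    ((M.measurable_additiveFunctional f ht).const_mul r).exp.aestronglyMeasurable
    (Real.exp (|r| * (‖f‖ * t))) (ae_of_all _ fun ω => ?_)
  rw [Real.norm_eq_abs, Real.abs_exp, Real.exp_le_exp]
  refine (le_abs_self _).trans ?_
  rw [abs_mul]
  exact mul_le_mul_of_nonneg_left (M.abs_additiveFunctional_le f t ω) (abs_nonneg r)

/-- The exponential moments of the additive functional are controlled by the numerical range of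
`L + r M_f`. -/
theorem integral_exp_additiveFunctional_le {M : MarkovJumpProcess Ω E} (hirr : M.IsIrreducible)
    {π : E → ℝ} (hπ : M.IsInvariant π) {ν : E → ℝ} (hν : ν ∈ stdSimplex ℝ E) (f : E → ℝ) {r Λ : ℝ}
    (hΛ : ∀ g, ip π ((M.generator + r • mulOp f) g) g ≤ Λ * ip π g g) {t : ℝ≥0} (ht : 0 < t) :
    ∫ ω, Real.exp (r * M.additiveFunctional f t ω) ∂(M.law ν) ≤
      norm2 π (fun x => ν x / π x) * Real.exp (t * Λ) := by
  have hpos := hπ.pos hirr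
  have hP := M.isProbabilityMeasure
  have := M.isProbabilityMeasure_law hν
  have : Nonempty E := by
    by_contra hE
    rw [not_nonempty_iff] at hE
    simpa using hν.2
  have hN : 0 ≤ norm2 π (fun x => ν x / π x) := Real.sqrt_nonneg _
  set h : ℕ → ℝ≥0 := fun n => t / (n + 1 : ℕ) with hh
  set S : ℕ → Ω → ℝ := fun n ω => ∑ k ∈ Finset.range (n + 1),
    (h n : ℝ) * f (M.X ((k + 1 : ℕ) * h n) ω) with hS
  set T : ℕ → Module.End ℝ (E → ℝ) := fun n =>
    M.tilted (fun x => Real.exp (r * (h n * f x))) (h n) with hTdef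
  have hnt : ∀ n : ℕ, ((n + 1 : ℕ) : ℝ) * h n = t := fun n => by
    simp only [hh]
    push_cast
    field_simp
  have hSm : ∀ n, Measurable (S n) := fun n =>
    Finset.measurable_fun_sum _ fun _ _ =>
      ((measurable_of_finite f).comp (M.measurable_X _)).const_mul _
  have hSb : ∀ n ω, |S n ω| ≤ ‖f‖ * t := by
    intro n ω
    calc |S n ω| ≤ ∑ k ∈ Finset.range (n + 1), |(h n : ℝ) * f (M.X ((k + 1 : ℕ) * h n) ω)| :=
          Finset.abs_sum_le_sum_abs _ _
      _ ≤ ∑ k ∈ Finset.range (n + 1), (h n : ℝ) * ‖f‖ := by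
          refine Finset.sum_le_sum fun k _ => ?_
          rw [abs_mul, NNReal.abs_eq]
          exact mul_le_mul_of_nonneg_left (M.norm_apply_X_le f _ ω) (h n).coe_nonneg
      _ = ‖f‖ * t := by
          rw [Finset.sum_const, Finset.card_range, nsmul_eq_mul, ← mul_assoc, hnt, mul_comm]
  have hSe : ∀ n ω, ‖Real.exp (r * S n ω)‖ ≤ Real.exp (|r| * (‖f‖ * t)) := by
    intro n ω
    rw [Real.norm_eq_abs, Real.abs_exp, Real.exp_le_exp]
    refine (le_abs_self _).trans ?_
    rw [abs_mul]
    exact mul_le_mul_of_nonneg_left (hSb n ω) (abs_nonneg r)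
  have hSem : ∀ n, Measurable fun ω => Real.exp (r * S n ω) := fun n =>
    ((hSm n).const_mul r).exp
  have hlim : Tendsto (fun n => ∫ ω, Real.exp (r * S n ω) ∂(M.law ν)) atTop
      (𝓝 (∫ ω, Real.exp (r * M.additiveFunctional f t ω) ∂(M.law ν))) :=
    tendsto_integral_of_dominated_convergence (fun _ => Real.exp (|r| * (‖f‖ * t)))
      (fun n => (hSem n).aestronglyMeasurable) (integrable_const _)
      (fun n => ae_of_all _ (hSe n))
      (ae_of_all _ fun ω => ((M.tendsto_riemannSum f ht ω).const_mul r).rexp)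
  -- The moment of the Riemann sum pairs the density of $\nu$ with a power of the tilted operator,
  -- ready for Cauchy-Schwarz.
  have hval : ∀ n, ∫ ω, Real.exp (r * S n ω) ∂(M.law ν) =
      ip π (fun x => ν x / π x) ((T n ^ (n + 1)) (fun _ => 1)) := by
    intro n
    rw [M.integral_law hν fun x =>
      Integrable.of_bound (hSem n).aestronglyMeasurable _ (ae_of_all _ (hSe n)), ip]
    refine Finset.sum_congr rfl fun x _ => ?_
    have := (hpos x).ne'
    rw [← integral_prod_eq_tilted_pow, ← mul_assoc, mul_div_cancel₀ _ this]
    congr 1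
    refine integral_congr_ae (ae_of_all _ fun ω => ?_)
    simp only [hS, Finset.mul_sum, Real.exp_sum]
  have hone : ip π (fun _ => 1) (fun _ => 1) = 1 := by
    simpa [ip] using hπ.1.2
  have hseq : Tendsto h atTop (𝓝[>] 0) := by
    refine tendsto_nhdsWithin_iff.2 ⟨?_, Eventually.of_forall fun n => ?_⟩
    · rw [← NNReal.tendsto_coe]
      exact ((tendsto_const_div_atTop_nhds_zero_nat (t : ℝ)).comp (tendsto_add_atTop_nat 1)).congr
        fun n => by simp [hh]
    · exact div_pos ht (by positivity)
  -- The growth rate is only `Λ + ε` for small steps; the loss is removed afterwards by `ε → 0`.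
  have hbound : ∀ ε > 0, ∫ ω, Real.exp (r * M.additiveFunctional f t ω) ∂(M.law ν) ≤
      norm2 π (fun x => ν x / π x) * Real.exp (t * (Λ + ε)) := by
    intro ε hε
    refine le_of_tendsto hlim ?_
    filter_upwards [hseq.eventually (eventually_ip_apply_le hpos hπ.1.2
      (M.tendsto_tilted_exp f r) hΛ hε)] with n hn
    rw [hval]
    refine (ip_le_norm2_mul hpos _ _).trans (mul_le_mul_of_nonneg_left ?_ hN)
    have h1 := ip_pow_apply_le (T := T n) (Real.exp_nonneg _) hn (n + 1) (fun _ => 1)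
    rw [hone, mul_one, ← Real.exp_nat_mul] at h1
    refine Real.sqrt_le_iff.2 ⟨Real.exp_nonneg _, h1.trans (le_of_eq ?_)⟩
    rw [← Real.exp_nat_mul]
    congr 1
    linear_combination 2 * (Λ + ε) * hnt n
  have hc : Tendsto (fun ε : ℝ => norm2 π (fun x => ν x / π x) * Real.exp (t * (Λ + ε))) (𝓝[>] 0)
      (𝓝 (norm2 π (fun x => ν x / π x) * Real.exp (t * (Λ + 0)))) := by
    refine Tendsto.mono_left (Continuous.tendsto ?_ 0) nhdsWithin_le_nhds
    fun_prop
  rw [add_zero] at hc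
  exact ge_of_tendsto hc (eventually_mem_nhdsWithin.mono hbound)

end MarkovJumpProcess

/-! ### Optimal exponent and conclusion -/

/-- The exponent that optimizes a Chernoff bound of Bernstein type. -/
theorem exists_bernstein_exponent {v c u : ℝ} (hv : 0 < v) (hc : 0 < c) (hu : 0 ≤ u) :
    ∃ r : ℝ, 0 ≤ r ∧ 0 < 1 - c * r ∧
      r ^ 2 * (v / 2) / (1 - c * r) - r * u =
        -(2 * u ^ 2 / (v * (1 + √(1 + 2 * c * u / v)) ^ 2)) := by
  set s := √(1 + 2 * c * u / v) with hs
  have harg : 0 < 1 + 2 * c * u / v := by positivity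
  have hs0 : 0 < s := Real.sqrt_pos.2 harg
  have hs2 : s ^ 2 = 1 + 2 * c * u / v := Real.sq_sqrt harg.le
  have hcu : 2 * c * u = v * (s ^ 2 - 1) := by
    rw [hs2]
    field_simp
    ring
  -- Setting the derivative in $r$ to zero, with $q=1-cr$, gives $\frac{v}{2c}(q^{-2}-1)=u$, that is
  -- $q=1/s$; solving for $r$ yields the witness.
  have hr : 1 - c * (2 * u / (v * s * (1 + s))) = 1 / s := by
    have : 1 + s ≠ 0 := by positivity
    field_simp
    linear_combination -hcu
  refine ⟨2 * u / (v * s * (1 + s)), by positivity, by rw [hr]; positivity, ?_⟩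
  rw [hr]
  field_simp
  ring

open MarkovJumpProcess WeightedL2 in
theorem theorem3p24 {Ω E : Type*} [MeasurableSpace Ω] [Fintype E] [MeasurableSpace E]
    [DiscreteMeasurableSpace E] (M : MarkovJumpProcess Ω E) (hirr : M.IsIrreducible)
    (π : E → ℝ) (hπ : M.IsInvariant π) (ν : E → ℝ) (hν : ν ∈ stdSimplex ℝ E)
    (f : E → ℝ) (hf : f ≠ 0) (hfπ : ∑ x, π x * f x = 0) :
    (∀ t u : ℝ, 0 < t → 0 ≤ u →
      (M.law ν).real {ω | u ≤ M.additiveFunctional f t ω / t} ≤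
        WeightedL2.norm2 π (fun x => ν x / π x) *
          Real.exp (-(2 * t * u ^ 2 /
            (M.sigmaHatSq π f *
              (1 + Real.sqrt (1 + 2 * ‖f⁺‖ * u / (M.spectralGap π * M.sigmaHatSq π f))) ^ 2)))) ∧
    (∀ r : ℝ, 0 ≤ r → r < M.spectralGap π / ‖f⁺‖ →
      M.topEigenvalue π f r ≤
        (r ^ 2 * (M.sigmaHatSq π f / 2)) / (1 - ‖f⁺‖ / M.spectralGap π * r)) := by
  have hpos := hπ.pos hirr
  have hT := symGenerator_symmetric hirr hπ
  have hneg := ip_symGenerator_nonpos hirr hπ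
  have hker := fun g => eq_const_of_symGenerator (g := g) hirr hπ
  obtain ⟨hl, hgap⟩ := gap_pos_and_gap_mul_ip_le hpos hT hneg hker hf hfπ
  change 0 < M.spectralGap π at hl
  have hv2 : M.sigmaHatSq π f / 2 = -ip π f (reducedResolvent (M.symGenerator π) 0 f) := by
    rw [sigmaHatSq]
    ring
  have hv : 0 < M.sigmaHatSq π f := by
    linarith [ip_reducedResolvent_neg hpos hT hneg hker hf hfπ]
  have hfK : ∀ x, f x ≤ ‖f⁺‖ := fun x =>
    (le_posPart f x).trans ((le_abs_self _).trans (norm_le_pi_norm f⁺ x))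
  -- If $f^+=0$ then $f\le0$ with mean zero under strictly positive weights, so $f=0$.
  have hK : 0 < ‖f⁺‖ := by
    refine lt_of_le_of_ne (norm_nonneg _) fun h0 => hf (funext fun x => ?_)
    have h1 : ∀ y ∈ Finset.univ, π y * f y ≤ 0 := fun y _ =>
      mul_nonpos_of_nonneg_of_nonpos (hpos y).le (h0 ▸ hfK y)
    have h2 := (Finset.sum_eq_zero_iff_of_nonpos h1).1 hfπ x (Finset.mem_univ x)
    simpa [(hpos x).ne'] using h2
  have hform : ∀ r : ℝ, 0 ≤ r → 0 < 1 - ‖f⁺‖ / M.spectralGap π * r → ∀ g,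
      ip π (M.symGenerator π g) g + r * ip π (f * g) g ≤
        r ^ 2 * (M.sigmaHatSq π f / 2) / (1 - ‖f⁺‖ / M.spectralGap π * r) * ip π g g := by
    intro r hr hrK g
    rw [hv2]
    exact ip_apply_add_mul_le hpos hπ.1.2 hT hneg (symGenerator_const hirr hπ) hl hgap hfK hK.le hfπ
      (apply_reducedResolvent_zero hpos hT hker hfπ) hr hrK g
  refine ⟨fun t u ht hu => ?_, fun r hr hrl => ?_⟩
  · lift t to ℝ≥0 using ht.le
    have ht' : 0 < t := NNReal.coe_pos.1 ht
    obtain ⟨r, hr, hrK, hopt⟩ := exists_bernstein_exponent hv (div_pos hK hl) hu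
    have := M.isProbabilityMeasure_law hν
    have hmgf := integral_exp_additiveFunctional_le hirr hπ hν f
      -- $L$ and its symmetrisation have the same quadratic form, so the symmetric estimate applies
      -- to $L+rM_f$.
      (fun g => by
        have h := hform r hr hrK g
        rw [ip_symGenerator_self hirr hπ] at h
        rw [LinearMap.add_apply, LinearMap.smul_apply, ip_add_left, ip_smul_left]
        exact h) ht'
    have hch := ProbabilityTheory.measure_ge_le_exp_mul_mgf (μ := M.law ν)
      (X := M.additiveFunctional f t) (u * t) hr
      (M.integrable_exp_additiveFunctional f r ht' _)
    have hset : {ω | u ≤ M.additiveFunctional f t ω / t} =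
        {ω | u * t ≤ M.additiveFunctional f t ω} := by
      ext ω
      exact le_div_iff₀ ht
    rw [hset]
    refine hch.trans ((mul_le_mul_of_nonneg_left hmgf (Real.exp_nonneg _)).trans (le_of_eq ?_))
    rw [mul_left_comm, ← Real.exp_add]
    have e : 2 * ‖f⁺‖ * u / (M.spectralGap π * M.sigmaHatSq π f) =
        2 * (‖f⁺‖ / M.spectralGap π) * u / M.sigmaHatSq π f := by
      field_simp
    rw [e]
    congr 2
    rw [show ∀ a : ℝ, 2 * (t : ℝ) * u ^ 2 / a = t * (2 * u ^ 2 / a) from fun a => by ring]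
    linear_combination (t : ℝ) * hopt
  · have hrK : 0 < 1 - ‖f⁺‖ / M.spectralGap π * r := by
      rw [lt_div_iff₀ hK] at hrl
      rw [sub_pos, div_mul_eq_mul_div, div_lt_one hl, mul_comm]
      exact hrl
    refine sSup_spectrum_le hpos (by positivity) fun g => ?_
    rw [LinearMap.add_apply, LinearMap.smul_apply, ip_add_left, ip_smul_left]
    exact hform r hr hrK g
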